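/- Call a separable, completely metrizable real topological vector space a separable Fréchet space (local convexity is not required), and view it as a Polish group under addition. For a Polish group $G$ with identity $1_G$, let $E(G)$ be the equivalence relation on $G^{\omega}$ given by $x\,E(G)\,y$ iff the sequence $x(n)y(n)^{-1}$ converges in $G$. For equivalence relations $E,F$ on Polish spaces $A,B$, write $E\le_B F$ if there is a Borel map $f:A\to B$ such that $x\,E\,y\iff f(x)\,F\,f(y)$ for all $x,y\in A$. A Polish group is TSI if it admits a compatible two-sided invariant metric. A Polish group $G$ is strongly NSS if there is an open set $V\ni 1_G$ such that for every sequence $(g_n)\in G^{\omega}$ that does not converge to $1_G$ there are $n_0<\dots<n_k$ with $g_{n_0}\cdots g_{n_k}\notin V$. Theorem (Rigid Theorem for Fréchet spaces). Let $X$ and $Y$ be separable Fréchet spaces such that the additive topological group $Y$ is topologically isomorphic to a closed subgroup of a product $\prod_{m\in\omega}H_m$ of a sequence of TSI strongly NSS Polish groups $H_m$. Then $E(X)\le_B E(Y)$ if and only if $X$ is topologically isomorphic (by a linear homeomorphism) to a closed linear subspace of $Y$. -/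

import Mathlib

open Filter Topology

/-- The equivalence relation `E(G)` on `G^ω` induced by a topological group `G`:
`x E(G) y` iff the sequence `x(n) y(n)⁻¹` converges in `G`. -/
def inducedRel (G : Type*) [Group G] [TopologicalSpace G] [IsTopologicalGroup G] :
    Setoid (ℕ → G) where
  r x y := ∃ g : G, Tendsto (fun n => x n * (y n)⁻¹) atTop (𝓝 g)
  iseqv :=
    { refl := fun x => ⟨1, by simpa using tendsto_const_nhds⟩
      symm := by
        rintro x y ⟨g, hg⟩
        exact ⟨g⁻¹, by simpa using hg.inv⟩
      trans := by
        rintro x y z ⟨g, hg⟩ ⟨h, hh⟩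
        exact ⟨g * h, by simpa [mul_assoc] using hg.mul hh⟩ }

/-- Borel reducibility `E ≤_B F` of equivalence relations on topological spaces: there is a
Borel map `f` with `x E y ↔ f x F f y`. -/
def BorelReducible {α β : Type*} [TopologicalSpace α] [TopologicalSpace β]
    (E : Setoid α) (F : Setoid β) : Prop :=
  ∃ f : α → β, @Measurable α β (borel α) (borel β) f ∧ ∀ x y : α, E x y ↔ F (f x) (f y)

/-- A topological group is TSI if it admits a compatible two-sided invariant metric. -/
def IsTSI (G : Type*) [Group G] [t : TopologicalSpace G] : Prop :=
  ∃ d : MetricSpace G, d.toUniformSpace.toTopologicalSpace = t ∧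
    (∀ g h k : G, d.dist (g * h) (g * k) = d.dist h k) ∧
    (∀ g h k : G, d.dist (h * g) (k * g) = d.dist h k)

/-- A topological group is strongly NSS if some open `V ∋ 1` is such that for every sequence `g`
that does not converge to `1` (it may have no limit at all) there are `n 0 < ⋯ < n k` with
`g (n 0) * ⋯ * g (n k) ∉ V`. -/
def IsStronglyNSS (G : Type*) [Group G] [TopologicalSpace G] : Prop :=
  ∃ V : Set G, IsOpen V ∧ (1 : G) ∈ V ∧
    ∀ g : ℕ → G, ¬ Tendsto g atTop (𝓝 1) →
      ∃ (k : ℕ) (n : Fin (k + 1) → ℕ), StrictMono n ∧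
        (List.ofFn fun i => g (n i)).prod ∉ V

/-! A closed linear embedding of `X` into `Y` acts coordinatewise on sequences, which gives one
direction (`borelReducible_of_closed_submodule`). For the converse, fix a countable rational vector
space `Q` with dense image in `X` under `ι`. Feeding partial sums of `Q`-valued sequences into the
reduction gives a map `θ` such that `∑ (ι (z i) - ι (z' i))` converges iff `θ z - θ z'` does. Now
`θ` is continuous on a dense Gδ set, and changing finitely many coordinates changes it by a
convergent sequence. A Baire category argument inserts stabilizing segments between the free
coordinates, which makes `θ` almost additive (`exists_almost_additive_coding`). Up to summable
errors it is then a series `∑ φ i (x i)` (`exists_isSeriesReduction`).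

It remains to extract a linear map from `φ`. View a finitely supported sequence as a path in `X`
through its partial sums. Gluing bad paths into one convergent series shows that late paths with
small partial sums have small `φ`-images (`exists_nhds_path`). Late loops in a fixed neighbourhood
even have arbitrarily small images (`exists_nhds_loop`): otherwise the finite sums property, which
is strong NSS pulled back to `Y`, selects finitely many loops with images adding up to something
large, although these loops form a single path. Hence the image of a late path in that neighbourhood
asymptotically depends only on its end point. Walking to `g` in `k!` equal steps gives a limit `S
g`; `S` is additive and approximates `φ j` on small elements for late `j` (`exists_addMonoidHom`).
Balanced neighbourhoods suffice, so convexity plays no role.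

Finally `ι` and `S` induce the same neighbourhoods of zero. If `S g` could be small without `ι g`
being small, walks to such `g` and back in tiny steps would glue to a series with convergent image
in `Y`, with terms tending to zero in `X`, but divergent in `X` (`comap_ge_comap`). So `S` extends
to an embedding of `X` with complete, hence closed, range. -/

/-! ### Completeness of Polish groups, extension of additive maps, the easy direction -/

/-- In a completely metrizable abelian topological group every Cauchy sequence converges. -/
theorem exists_tendsto_of_tendsto_sub {G : Type*} [AddCommGroup G] [TopologicalSpace G]
    [IsTopologicalAddGroup G] [TopologicalSpace.IsCompletelyMetrizableSpace G] {y : ℕ → G}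
    (hy : Tendsto (fun p : ℕ × ℕ => y p.1 - y p.2) atTop (𝓝 0)) :
    ∃ l, Tendsto y atTop (𝓝 l) := by
  let := TopologicalSpace.upgradeIsCompletelyMetrizable G
  have hcauchy : ∀ U ∈ 𝓝 (0 : G), ∃ N, ∀ i ≥ N, ∀ j ≥ N, y i - y j ∈ U := by
    intro U hU
    obtain ⟨⟨a, b⟩, hab⟩ := mem_atTop_sets.1 (hy hU)
    exact ⟨max a b, fun i hi j hj =>
      hab (i, j) ⟨(le_max_left a b).trans hi, (le_max_right a b).trans hj⟩⟩
  -- The complete metric need not be invariant, so `y` need not be Cauchy for it. For generic `z`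
  -- the translate `z + y n` is, by Baire category, and a limit of it can be translated back.
  set O : ℕ → Set G := fun k => ⋃ N : ℕ, interior
    {z | ∀ n ≥ N, ∀ m ≥ N, dist (z + y n) (z + y m) ≤ 1 / ((k : ℝ) + 1)} with hO
  have hopen : ∀ k, IsOpen (O k) := fun k => isOpen_iUnion fun N => isOpen_interior
  have hdense : ∀ k, Dense (O k) := by
    intro k
    rw [dense_iff_inter_open]
    rintro B hB ⟨z₀, hz₀⟩
    have hB' : {u : G | z₀ + u ∈ B} ∈ 𝓝 (0 : G) := by
      have : Tendsto (fun u : G => z₀ + u) (𝓝 0) (𝓝 z₀) := by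
        simpa using (continuous_const_add z₀).tendsto 0
      exact this (hB.mem_nhds hz₀)
    obtain ⟨N, hN⟩ := hcauchy _ hB'
    set w := z₀ + y N
    have hε : (0 : ℝ) < 1 / ((k : ℝ) + 1) := by positivity
    have hU : {u : G × G | dist (w + (u.1 + u.2)) w < 1 / ((k : ℝ) + 1) / 2} ∈
        𝓝 ((0 : G), (0 : G)) := by
      have : Tendsto (fun u : G × G => w + (u.1 + u.2)) (𝓝 (0, 0)) (𝓝 w) := by
        have h : Continuous fun u : G × G => w + (u.1 + u.2) := by fun_prop
        simpa using h.tendsto (0, 0)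
      exact this (Metric.ball_mem_nhds w (half_pos hε))
    rw [nhds_prod_eq] at hU
    obtain ⟨U, hU0, V, hV0, hUV⟩ := mem_prod_iff.1 hU
    obtain ⟨N', hN'⟩ := hcauchy V hV0
    set M := max N N'
    -- This point is `z₀ + (y N - y M)`, hence still in `B`; its translates by late `y n` stay near
    -- `w`.
    refine ⟨w - y M, ?_, Set.mem_iUnion_of_mem M ?_⟩
    · have := hN N le_rfl M (le_max_left _ _)
      simpa [w, add_sub_assoc] using this
    · rw [mem_interior_iff_mem_nhds]
      have hnear : {z : G | z - (w - y M) ∈ U} ∈ 𝓝 (w - y M) := by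
        have : Tendsto (fun z : G => z - (w - y M)) (𝓝 (w - y M)) (𝓝 0) := by
          simpa using (continuous_sub_right (w - y M)).tendsto (w - y M)
        exact this hU0
      filter_upwards [hnear] with z hz n hn m hm
      have key : ∀ n ≥ M, dist (z + y n) w < 1 / ((k : ℝ) + 1) / 2 := by
        intro n hn
        have h := hUV (Set.mk_mem_prod hz
          (hN' n ((le_max_right _ _).trans hn) M (le_max_right _ _)))
        have e : w + (z - (w - y M) + (y n - y M)) = z + y n := by abel
        simpa [e] using h
      have h1 := key n hn
      have h2 := key m hm
      have := dist_triangle_right (z + y n) (z + y m) w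
      linarith
  obtain ⟨z, hz⟩ := (dense_iInter_of_isOpen hopen hdense).nonempty
  have hc : CauchySeq fun n => z + y n := by
    rw [Metric.cauchySeq_iff]
    intro ε hε
    obtain ⟨k, hk⟩ := exists_nat_one_div_lt hε
    obtain ⟨N, hN⟩ := Set.mem_iUnion.1 (Set.mem_iInter.1 hz k)
    exact ⟨N, fun m hm n hn => (interior_subset hN m hm n hn).trans_lt hk⟩
  obtain ⟨l, hl⟩ := cauchySeq_tendsto_of_complete hc
  exact ⟨-z + l, by simpa using hl.const_add (-z)⟩

/-- A Polish abelian topological group is complete for its group uniformity. -/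
theorem completeSpace_of_polishSpace (G : Type*) [AddCommGroup G] [UniformSpace G]
    [IsUniformAddGroup G] [PolishSpace G] : CompleteSpace G := by
  have : (uniformity G).IsCountablyGenerated :=
    IsUniformAddGroup.uniformity_countably_generated
  refine UniformSpace.complete_of_cauchySeq_tendsto fun u hu => ?_
  apply exists_tendsto_of_tendsto_sub
  have h : Tendsto (Prod.map u u) atTop (uniformity G) := cauchySeq_iff_tendsto.1 hu
  rw [uniformity_eq_comap_nhds_zero_swapped, tendsto_comap_iff] at h
  exact h

/-- An additive map defined on a group with dense image in `X`, which induces the same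
neighbourhoods of zero, extends to a linear homeomorphism onto a closed subspace. -/
theorem exists_closed_submodule_of_comap_eq {X Y Q : Type*}
    [AddCommGroup X] [Module ℝ X] [TopologicalSpace X] [IsTopologicalAddGroup X]
    [ContinuousSMul ℝ X] [PolishSpace X]
    [AddCommGroup Y] [Module ℝ Y] [TopologicalSpace Y] [IsTopologicalAddGroup Y]
    [ContinuousSMul ℝ Y] [PolishSpace Y] [AddCommGroup Q] (ι : Q →+ X) (hι : DenseRange ι)
    (S : Q →+ Y) (h : comap ι (𝓝 0) = comap S (𝓝 0)) :
    ∃ Z : Submodule ℝ Y, IsClosed (Z : Set Y) ∧ Nonempty (X ≃L[ℝ] Z) := by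
  let := IsTopologicalAddGroup.rightUniformSpace X
  let := IsTopologicalAddGroup.rightUniformSpace Y
  have : IsUniformAddGroup X := isUniformAddGroup_of_addCommGroup
  have : IsUniformAddGroup Y := isUniformAddGroup_of_addCommGroup
  have := completeSpace_of_polishSpace X
  have := completeSpace_of_polishSpace Y
  let : UniformSpace Q := UniformSpace.comap ι inferInstance
  have hιu : IsUniformInducing ι := ⟨rfl⟩
  -- `ι` need not be injective, so the uniformity on `Q` may fail to be Hausdorff; group
  -- uniformities are determined at zero, so `h` identifies the two pullbacks.
  have hSu : IsUniformInducing S := by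
    refine ⟨?_⟩
    rw [← hιu.comap_uniformity, uniformity_eq_comap_nhds_zero, uniformity_eq_comap_nhds_zero,
      comap_comap, comap_comap]
    have e1 : (fun x : X × X => x.2 - x.1) ∘ (fun x : Q × Q => (ι x.1, ι x.2)) =
        ι ∘ fun x : Q × Q => x.2 - x.1 := by ext; simp
    have e2 : (fun x : Y × Y => x.2 - x.1) ∘ (fun x : Q × Q => (S x.1, S x.2)) =
        S ∘ fun x : Q × Q => x.2 - x.1 := by ext; simp
    rw [e1, e2, ← comap_comap, ← comap_comap, h]
  have hd : IsDenseInducing ι := hιu.isDenseInducing hι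
  have hT : IsUniformInducing (hd.extend S) := hd.isUniformInducing_extend hιu hSu
  have hTc := hT.uniformContinuous.continuous
  have hTι : ∀ g, hd.extend S (ι g) = S g := fun g =>
    uniformly_extend_of_ind hιu hι hSu.uniformContinuous g
  let T : X →+ Y :=
    { toFun := hd.extend S
      map_zero' := by rw [← map_zero ι, hTι, map_zero]
      map_add' := by
        intro x y
        refine DenseRange.induction_on₂ (p := fun x y =>
          hd.extend S (x + y) = hd.extend S x + hd.extend S y) hι ?_ ?_ x y
        · exact isClosed_eq (by fun_prop) (by fun_prop)
        · intro a b
          rw [← map_add, hTι, hTι, hTι, map_add] }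
  let T' : X →L[ℝ] Y := T.toRealLinearMap hTc
  have hemb : IsUniformEmbedding T' := hT.isUniformEmbedding
  have hcl : IsClosed (T'.range : Set Y) := by
    have : IsComplete (Set.range T') := hemb.isUniformInducing.isComplete_range
    have h := this.isClosed
    rwa [← ContinuousLinearMap.coe_coe, ← LinearMap.coe_range] at h
  refine ⟨T'.range, hcl, ⟨?_⟩⟩
  refine ContinuousLinearEquiv.mk (LinearEquiv.ofInjective (T' : X →ₗ[ℝ] Y) hemb.injective) ?_ ?_
  · exact Continuous.subtype_mk hTc _
  · refine hemb.isEmbedding.isInducing.continuous_iff.2 ?_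
    refine continuous_subtype_val.congr fun z => ?_
    have := (LinearEquiv.ofInjective (T' : X →ₗ[ℝ] Y) hemb.injective).apply_symm_apply z
    exact (congrArg Subtype.val this).symm

/-- A closed embedding of `X` into `Y` reduces `E(X)` to `E(Y)`. -/
theorem borelReducible_of_closed_submodule {X Y : Type*}
    [AddCommGroup X] [Module ℝ X] [TopologicalSpace X] [IsTopologicalAddGroup X]
    [AddCommGroup Y] [Module ℝ Y] [TopologicalSpace Y] [IsTopologicalAddGroup Y]
    (Z : Submodule ℝ Y) (hZ : IsClosed (Z : Set Y)) (e : X ≃L[ℝ] Z) :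
    BorelReducible (inducedRel (Multiplicative X)) (inducedRel (Multiplicative Y)) := by
  have hemb : IsClosedEmbedding fun x : X => (e x : Y) :=
    hZ.isClosedEmbedding_subtypeVal.comp e.toHomeomorph.isClosedEmbedding
  refine ⟨fun x n => Multiplicative.ofAdd (e (x n).toAdd : Y), ?_, fun x y => ?_⟩
  · apply Continuous.borel_measurable
    exact continuous_pi fun n => hemb.continuous.comp (continuous_apply n)
  · have hsub : ∀ n, (e (x n * (y n)⁻¹).toAdd : Y) =
        (e (x n).toAdd : Y) - (e (y n).toAdd : Y) := fun n => by
      simp [sub_eq_add_neg]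
    have hmul : ∀ n, (Multiplicative.ofAdd (e (x n).toAdd : Y) *
        (Multiplicative.ofAdd (e (y n).toAdd : Y))⁻¹).toAdd =
        (e (x n * (y n)⁻¹).toAdd : Y) := fun n => by
      rw [hsub, toAdd_mul, toAdd_inv, sub_eq_add_neg]; rfl
    constructor
    · rintro ⟨g, hg⟩
      refine ⟨Multiplicative.ofAdd (e g.toAdd : Y), ?_⟩
      exact ((hemb.continuous.tendsto (Multiplicative.toAdd g)).comp hg).congr
        fun n => (hmul n).symm
    · rintro ⟨g, hg⟩
      have hg' : Tendsto (fun n => (e (x n * (y n)⁻¹).toAdd : Y)) atTop (𝓝 g.toAdd) :=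
        Tendsto.congr hmul hg
      obtain ⟨a, ha⟩ : Multiplicative.toAdd g ∈ Set.range fun x : X => (e x : Y) :=
        hemb.isClosed_range.mem_of_tendsto hg' (Eventually.of_forall fun n => ⟨_, rfl⟩)
      refine ⟨Multiplicative.ofAdd a, ?_⟩
      rw [← ha] at hg'
      exact hemb.isInducing.tendsto_nhds_iff.2 hg'

/-! ### Baire category: making a Borel reduction almost additive -/

/-- A Borel map into a second countable space is continuous on a dense `Gδ` set. -/
theorem exists_dense_continuousOn {P Z : Type*} [TopologicalSpace P] [BaireSpace P]
    [TopologicalSpace Z] [SecondCountableTopology Z] (θ : P → Z)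
    (hθ : @Measurable P Z (borel P) (borel Z) θ) :
    ∃ O : ℕ → Set P, (∀ i, IsOpen (O i)) ∧ (∀ i, Dense (O i)) ∧ ContinuousOn θ (⋂ i, O i) := by
  borelize P Z
  have h : ∀ B ∈ TopologicalSpace.countableBasis Z, ∃ u : Set P, IsOpen u ∧
      θ ⁻¹' B =ᶠ[residual P] u := fun B hB =>
    (hθ (TopologicalSpace.isOpen_of_mem_countableBasis hB).measurableSet).residualEq_isOpen
  choose! u hu hBu using h
  have hres : ∀ᶠ z in residual P, ∀ B ∈ TopologicalSpace.countableBasis Z,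
      (z ∈ θ ⁻¹' B ↔ z ∈ u B) := by
    rw [eventually_countable_ball (TopologicalSpace.countable_countableBasis Z)]
    exact fun B hB => (hBu B hB).mem_iff
  obtain ⟨t, ht, htG, htd⟩ := mem_residual.1 hres
  obtain ⟨O, hO, rfl⟩ := isGδ_iff_eq_iInter_nat.1 htG
  refine ⟨O, hO, fun i => htd.mono (Set.iInter_subset _ _), ?_⟩
  intro z hz
  rw [ContinuousWithinAt,
    ((TopologicalSpace.isBasis_countableBasis Z).nhds_hasBasis).tendsto_right_iff]
  rintro B ⟨hB, hzB⟩
  filter_upwards [mem_nhdsWithin_of_mem_nhds ((hu B hB).mem_nhds ((ht hz B hB).1 hzB)),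
    self_mem_nhdsWithin] with w hw hwt
  exact (ht hwt B hB).2 hw

/-- The sequence with the values of `a` below `n` and those of `z` from `n` on. -/
def splice {Q : Type*} (n : ℕ) (a z : ℕ → Q) : ℕ → Q := fun i => if i < n then a i else z i

theorem splice_of_lt {Q : Type*} {n i : ℕ} (a z : ℕ → Q) (h : i < n) : splice n a z i = a i :=
  if_pos h

theorem splice_of_le {Q : Type*} {n i : ℕ} (a z : ℕ → Q) (h : n ≤ i) : splice n a z i = z i :=
  if_neg h.not_gt

theorem splice_splice {Q : Type*} (n : ℕ) (a b z : ℕ → Q) :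
    splice n a (splice n b z) = splice n a z := by
  funext i
  by_cases h : i < n <;> simp [splice, h]

section Baire

variable {Q : Type*} [TopologicalSpace Q]

theorem continuous_splice (n : ℕ) (a : ℕ → Q) : Continuous (splice n a) := by
  refine continuous_pi fun i => ?_
  by_cases h : i < n
  · simpa [splice, h] using continuous_const
  · simpa [splice, h] using continuous_apply i

variable [DiscreteTopology Q]

theorem exists_cylinder_subset {z : ℕ → Q} {s : Set (ℕ → Q)} (hs : s ∈ 𝓝 z) (n : ℕ) :
    ∃ m > n, ∀ w : ℕ → Q, (∀ i < m, w i = z i) → w ∈ s := by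
  obtain ⟨t, ⟨y, k, rfl⟩, hzt, hts⟩ :=
    (PiNat.isTopologicalBasis_cylinders (fun _ : ℕ => Q)).mem_nhds_iff.1 hs
  refine ⟨max k (n + 1), by simp, fun w hw => hts ?_⟩
  intro i hi
  rw [hw i (lt_max_of_lt_left hi)]
  exact hzt i hi

/-- Meet `O` in a cylinder around `splice n a z`, then put the first `n` coordinates of `z` back.
This lets one tail be generic for many initial strings at once. -/
theorem dense_splice_preimage {O : Set (ℕ → Q)} (hO : Dense O) (n : ℕ) (a : ℕ → Q) : Dense {z | splice n a z ∈ O} := by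
  rw [dense_iff_inter_open]
  rintro B hB ⟨z, hz⟩
  obtain ⟨m, hm, hmB⟩ := exists_cylinder_subset (hB.mem_nhds hz) n
  obtain ⟨w, hw, hwO⟩ := hO.inter_open_nonempty _ (PiNat.isOpen_cylinder _ (splice n a z) m)
    ⟨_, PiNat.self_mem_cylinder _ _⟩
  refine ⟨splice n z w, hmB _ fun i hi => ?_, ?_⟩
  · rcases lt_or_ge i n with h | h
    · exact splice_of_lt _ _ h
    · rw [splice_of_le _ _ h, hw i hi, splice_of_le _ _ h]
  · have : splice n a (splice n z w) = w := by
      rw [splice_splice]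
      funext i
      rcases lt_or_ge i n with h | h
      · rw [splice_of_lt _ _ h, hw i (h.trans hm), splice_of_lt _ _ h]
      · exact splice_of_le _ _ h
    simpa [this] using hwO

variable {Y : Type*} [AddCommGroup Y] [TopologicalSpace Y] [IsTopologicalAddGroup Y]

/-- If `θ` is continuous on a dense `Gδ` set and changing finitely many coordinates changes `θ`
by a Cauchy sequence, then a common tail segment `u` can be appended to finitely many strings such
that the effect on `θ` of switching strings is nearly constant from `l` on, while the values of `θ`
up to `l` nearly do not depend on later coordinates. -/
theorem exists_stabilizing_segment [Nonempty Q] [BaireSpace (ℕ → Q)] (θ : (ℕ → Q) → ℕ → Y)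
    {O : ℕ → Set (ℕ → Q)}
    (hO : ∀ i, IsOpen (O i)) (hOd : ∀ i, Dense (O i)) (hθ : ContinuousOn θ (⋂ i, O i))
    (q : AddGroupSeminorm Y) (hq : Continuous q)
    (hfin : ∀ n a a' z, ∀ ε > 0, ∃ K, ∀ m ≥ K, ∀ m' ≥ K,
      q ((θ (splice n a z) m - θ (splice n a' z) m) -
        (θ (splice n a z) m' - θ (splice n a' z) m')) ≤ ε)
    (i n l₀ : ℕ) (A : Finset (ℕ → Q)) {ε : ℝ} (hε : 0 < ε) :
    ∃ (n' l : ℕ) (u : ℕ → Q), n < n' ∧ l₀ < l ∧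
      (∀ a ∈ A, ∀ z : ℕ → Q, (∀ k, n ≤ k → k < n' → z k = u k) → splice n a z ∈ O i) ∧
      (∀ a ∈ A, ∀ a' ∈ A, ∀ z : ℕ → Q, (∀ k, n ≤ k → k < n' → z k = u k) →
        splice n a z ∈ ⋂ i, O i → splice n a' z ∈ ⋂ i, O i → ∀ m ≥ l, ∀ m' ≥ l,
          q ((θ (splice n a z) m - θ (splice n a' z) m) -
            (θ (splice n a z) m' - θ (splice n a' z) m')) ≤ ε) ∧
      (∀ a ∈ A, ∀ z z' : ℕ → Q, (∀ k, n ≤ k → k < n' → z k = u k) →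
        (∀ k, n ≤ k → k < n' → z' k = u k) →
        splice n a z ∈ ⋂ i, O i → splice n a z' ∈ ⋂ i, O i → ∀ m ≤ l,
          q (θ (splice n a z) m - θ (splice n a z') m) ≤ ε) := by
  set C := ⋂ i, O i with hC
  -- Tails that are generic after every string of `A` simultaneously; countably many dense open
  -- conditions because `A` is finite.
  set C' : Set (ℕ → Q) := ⋂ p : A × ℕ, {z | splice n p.1 z ∈ O p.2} with hC'
  have hC'o : ∀ p : A × ℕ, IsOpen {z | splice n p.1 z ∈ O p.2} := fun p =>
    (hO p.2).preimage (continuous_splice n (p.1 : ℕ → Q))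
  have hC'G : IsGδ C' := IsGδ.iInter_of_isOpen hC'o
  have hC'd : Dense C' := dense_iInter_of_isOpen hC'o fun p =>
    dense_splice_preimage (hOd p.2) n p.1
  have hC'mem : ∀ z ∈ C', ∀ a ∈ A, splice n a z ∈ C := fun z hz a ha =>
    Set.mem_iInter.2 fun i => Set.mem_iInter.1 hz (⟨a, ha⟩, i)
  have hcont : ∀ a ∈ A, ∀ E ⊆ C', ∀ z, splice n a z ∈ C → ∀ m,
      ContinuousWithinAt (fun z => θ (splice n a z) m) E z := by
    intro a ha E hE z hz m
    have h1 : ContinuousWithinAt (fun z => θ (splice n a z)) E z :=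
      (hθ _ hz).comp (continuous_splice n a).continuousWithinAt fun w hw => hC'mem w (hE hw) a ha
    exact (continuous_apply m).continuousAt.comp_continuousWithinAt h1
  -- By `hfin` these sets cover `C'`, so some closure has interior meeting `C'`. The shift `l₀ + 1`
  -- forces the new bound beyond `l₀`.
  set E : ℕ → Set (ℕ → Q) := fun l => {z | z ∈ C' ∧ ∀ a ∈ A, ∀ a' ∈ A, ∀ m ≥ l + l₀ + 1,
    ∀ m' ≥ l + l₀ + 1, q ((θ (splice n a z) m - θ (splice n a' z) m) -
            (θ (splice n a z) m' - θ (splice n a' z) m')) ≤ ε} with hE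
  have hcover : C' ⊆ ⋃ l, closure (E l) := by
    intro z hz
    have : ∀ p : A × A, ∃ K, ∀ m ≥ K, ∀ m' ≥ K,
        q ((θ (splice n p.1 z) m - θ (splice n p.2 z) m) -
        (θ (splice n p.1 z) m' - θ (splice n p.2 z) m')) ≤ ε := fun p =>
      hfin n p.1 p.2 z ε hε
    choose K hK using this
    have hle : ∀ p, K p ≤ ∑ p, K p := fun p =>
      Finset.single_le_sum (f := K) (fun _ _ => Nat.zero_le _) (Finset.mem_univ p)
    refine Set.mem_iUnion_of_mem (∑ p, K p) (subset_closure ⟨hz, fun a ha a' ha' m hm m' hm' => ?_⟩)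
    have := hle (⟨a, ha⟩, ⟨a', ha'⟩)
    exact hK (⟨a, ha⟩, ⟨a', ha'⟩) m (by omega) m' (by omega)
  have hdense := hC'G.dense_iUnion_interior_of_closed hC'd (fun l => isClosed_closure) hcover
  obtain ⟨y, hy⟩ := hdense.nonempty
  obtain ⟨l, hl⟩ := Set.mem_iUnion.1 hy
  obtain ⟨z₀, hz₀, hz₀C⟩ := hC'd.inter_open_nonempty _ isOpen_interior ⟨y, hl⟩
  have ev1 : ∀ᶠ z in 𝓝 z₀, ∀ a ∈ A, splice n a z ∈ O i := by
    rw [eventually_all_finset]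
    exact fun a ha => (hC'o (⟨a, ha⟩, i)).mem_nhds (Set.mem_iInter.1 hz₀C (⟨a, ha⟩, i))
  have ev2 : ∀ᶠ z in 𝓝 z₀, z ∈ closure (E l) :=
    mem_of_superset (isOpen_interior.mem_nhds hz₀) interior_subset
  have ev3 : ∀ᶠ z in 𝓝 z₀, ∀ a ∈ A, ∀ m ∈ Finset.range (l + l₀ + 2), splice n a z ∈ C →
      q (θ (splice n a z) m - θ (splice n a z₀) m) ≤ ε / 2 := by
    rw [eventually_all_finset]
    intro a ha
    rw [eventually_all_finset]
    intro m hm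
    have h1 : ContinuousWithinAt θ C (splice n a z₀) := hθ _ (hC'mem z₀ hz₀C a ha)
    have h2 : Tendsto (fun w => q (θ w m - θ (splice n a z₀) m)) (𝓝[C] (splice n a z₀)) (𝓝 0) := by
      have h3 : Tendsto (fun w => θ w m) (𝓝[C] (splice n a z₀)) (𝓝 (θ (splice n a z₀) m)) :=
        ((continuous_apply m).tendsto _).comp h1
      have h4 := (hq.tendsto _).comp (h3.sub_const (θ (splice n a z₀) m))
      simpa [Function.comp_def] using h4
    have h5 : ∀ᶠ w in 𝓝[C] (splice n a z₀), q (θ w m - θ (splice n a z₀) m) ≤ ε / 2 :=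
      (h2.eventually_lt_const (half_pos hε)).mono fun _ h => le_of_lt h
    rw [eventually_nhdsWithin_iff] at h5
    exact (continuous_splice n a).continuousAt.eventually h5
  obtain ⟨n', hn', hcyl⟩ := exists_cylinder_subset (ev1.and (ev2.and ev3)) n
  have hcyl' : ∀ z : ℕ → Q, (∀ k, n ≤ k → k < n' → z k = z₀ k) →
      splice n z₀ z ∈ {z | (∀ a ∈ A, splice n a z ∈ O i) ∧ z ∈ closure (E l) ∧
        ∀ a ∈ A, ∀ m ∈ Finset.range (l + l₀ + 2), splice n a z ∈ C →
      q (θ (splice n a z) m - θ (splice n a z₀) m) ≤ ε / 2} := by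
    intro z hz
    refine hcyl _ fun k hk => ?_
    rcases lt_or_ge k n with h | h
    · exact splice_of_lt _ _ h
    · rw [splice_of_le _ _ h, hz k h hk]
  refine ⟨n', l + l₀ + 1, z₀, hn', by omega, ?_, ?_, ?_⟩
  · intro a ha z hz
    have := (hcyl' z hz).1 a ha
    rwa [splice_splice] at this
  · intro a ha a' ha' z hz hza hza' m hm m' hm'
    have hcl := (hcyl' z hz).2.1
    set w := splice n z₀ z
    have e : ∀ b, splice n b w = splice n b z := fun b => splice_splice _ _ _ _
    rw [← e a, ← e a'] at *
    have hsub : E l ⊆ C' := fun z hz => hz.1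
    -- The estimate is known only on `E l`, which accumulates at `w`; continuity along generic
    -- points carries it over to `w`.
    have hlim := (((hcont a ha _ hsub w hza m).sub (hcont a' ha' _ hsub w hza' m)).sub
      ((hcont a ha _ hsub w hza m').sub (hcont a' ha' _ hsub w hza' m')))
    have hlim' := (hq.tendsto _).comp hlim
    have : (𝓝[E l] w).NeBot := mem_closure_iff_nhdsWithin_neBot.1 hcl
    refine le_of_tendsto hlim' ?_
    filter_upwards [self_mem_nhdsWithin] with v hv
    exact hv.2 a ha a' ha' m hm m' hm'
  · intro a ha z z' hz hz' hza hza' m hm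
    have hm' : m ∈ Finset.range (l + l₀ + 2) := Finset.mem_range.2 (by omega)
    have h1 := (hcyl' z hz).2.2 a ha m hm'
    have h2 := (hcyl' z' hz').2.2 a ha m hm'
    rw [splice_splice] at h1 h2
    have h3 : q (θ (splice n a z) m - θ (splice n a z') m) ≤
        q (θ (splice n a z) m - θ (splice n a z₀) m) +
        q (θ (splice n a z') m - θ (splice n a z₀) m) := by
      have := map_sub_le_add q (θ (splice n a z) m - θ (splice n a z₀) m)
        (θ (splice n a z') m - θ (splice n a z₀) m)
      simpa using this
    linarith [h1 hza, h2 hza']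

theorem StrictMono.exists_le_lt_succ {p : ℕ → ℕ} (hp : StrictMono p) {i : ℕ} (hi : p 0 ≤ i) :
    ∃ j, p j ≤ i ∧ i < p (j + 1) := by
  induction i, hi using Nat.le_induction with
  | base => exact ⟨0, le_rfl, hp zero_lt_one⟩
  | succ i hi ih =>
    obtain ⟨j, h1, h2⟩ := ih
    rcases Nat.lt_or_ge (i + 1) (p (j + 1)) with h | h
    · exact ⟨j, by omega, h⟩
    · exact ⟨j + 1, h, lt_of_le_of_lt h2 (hp (Nat.lt_succ_self (j + 1)))⟩

open Classical in
/-- Sequences with the `j`-th term in the finite set `F j` can be coded at positions `pos j` so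
that `θ` becomes almost additive on blocks of coordinates. -/
theorem exists_almost_additive_coding [Nonempty Q] [BaireSpace (ℕ → Q)] (θ : (ℕ → Q) → ℕ → Y)
    {O : ℕ → Set (ℕ → Q)}
    (hO : ∀ i, IsOpen (O i)) (hOd : ∀ i, Dense (O i)) (hθ : ContinuousOn θ (⋂ i, O i))
    (q : ℕ → AddGroupSeminorm Y) (hq : ∀ j, Continuous (q j))
    (hfin : ∀ j n a a' z, ∀ ε > 0, ∃ K, ∀ m ≥ K, ∀ m' ≥ K,
      q j ((θ (splice n a z) m - θ (splice n a' z) m) -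
        (θ (splice n a z) m' - θ (splice n a' z) m')) ≤ ε)
    (F : ℕ → Finset Q) {ε : ℕ → ℝ} (hε : ∀ j, 0 < ε j) :
    ∃ (pos L : ℕ → ℕ) (G : (ℕ → Q) → ℕ → Q), StrictMono pos ∧ StrictMono L ∧
      (∀ x j, G x (pos j) = x j) ∧ (∀ x y i, i ∉ Set.range pos → G x i = G y i) ∧
      (∀ x y, (∀ i, x i ∈ F i) → (∀ i, y i ∈ F i) → ∀ j, (∀ i > j, x i = y i) →
        ∀ m ≥ L j, ∀ m' ≥ L j,
          q j ((θ (G x) m - θ (G y) m) - (θ (G x) m' - θ (G y) m')) ≤ ε j) ∧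
      (∀ x y, (∀ i, x i ∈ F i) → (∀ i, y i ∈ F i) → ∀ j, (∀ i ≤ j, x i = y i) →
        ∀ m ≤ L j, q j (θ (G x) m - θ (G y) m) ≤ ε j) := by
  have hstage := fun (j n l : ℕ) (A : Finset (ℕ → Q)) =>
    exists_stabilizing_segment θ hO hOd hθ (q j) (hq j) (hfin j) j (n + 1) l A (hε j)
  choose N l u hN hl h1 h2 h3 using hstage
  obtain ⟨q₀⟩ := ‹Nonempty Q›
  -- A stage records the next free position, the current bound and the finitely many strings built
  -- so far; `A'` fills the free position with each element of `F j`.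
  let A' : ℕ → ℕ × ℕ × Finset (ℕ → Q) → Finset (ℕ → Q) := fun j st =>
    (st.2.2 ×ˢ F j).image fun p => Function.update p.1 st.1 p.2
  let st : ℕ → ℕ × ℕ × Finset (ℕ → Q) := fun j => Nat.rec (0, 0, {fun _ => q₀}) (fun j st =>
    (N j st.1 st.2.1 (A' j st), l j st.1 st.2.1 (A' j st),
      (A' j st).image fun a => splice (st.1 + 1) a (u j st.1 st.2.1 (A' j st)))) j
  let pos : ℕ → ℕ := fun j => (st j).1
  let L : ℕ → ℕ := fun j => (st j).2.1
  let A : ℕ → Finset (ℕ → Q) := fun j => A' j (st j)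
  let v : ℕ → ℕ → Q := fun j => u j (pos j) (L j) (A j)
  let s : (ℕ → Q) → ℕ → ℕ → Q := fun x j => Nat.rec (fun _ => q₀) (fun j s =>
    splice (pos j + 1) (Function.update s (pos j) (x j)) (v j)) j
  have hpos1 : ∀ j, pos j + 1 < pos (j + 1) := fun j => hN _ _ _ _
  have hpos : StrictMono pos := strictMono_nat_of_lt_succ fun j => by have := hpos1 j; omega
  have hpos0 : pos 0 = 0 := rfl
  have hL : StrictMono L := strictMono_nat_of_lt_succ fun j => hl _ _ _ _
  have hs_succ : ∀ x j, s x (j + 1) =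
      splice (pos j + 1) (Function.update (s x j) (pos j) (x j)) (v j) := fun _ _ => rfl
  have hs_stable : ∀ x j k, j ≤ k → ∀ i < pos j, s x k i = s x j i := by
    intro x j k hjk
    induction k, hjk using Nat.le_induction with
    | base => exact fun _ _ => rfl
    | succ k hk ih =>
      intro i hi
      have : i < pos k := hi.trans_le (hpos.monotone hk)
      rw [hs_succ, splice_of_lt _ _ (by omega), Function.update_of_ne this.ne, ih i hi]
  -- Stage `i + 1` already fixes coordinate `i`, since `i < pos (i + 1)`.
  let G : (ℕ → Q) → ℕ → Q := fun x i => s x (i + 1) i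
  have hG : ∀ x j, ∀ i < pos j, G x i = s x j i := by
    intro x j i hi
    have hi' : i < pos (i + 1) := hpos.le_apply (x := i + 1)
    rcases le_total j (i + 1) with h | h
    · exact hs_stable x _ _ h i hi
    · exact (hs_stable x _ _ h i hi').symm
  have hGpos : ∀ x j, G x (pos j) = x j := by
    intro x j
    rw [hG x (j + 1) _ (hpos (Nat.lt_succ_self j)), hs_succ, splice_of_lt _ _ (by omega),
      Function.update_self]
  have hGv : ∀ x j i, pos j + 1 ≤ i → i < pos (j + 1) → G x i = v j i := by
    intro x j i h h'
    rw [hG x (j + 1) i h', hs_succ, splice_of_le _ _ h]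
  have hGrange : ∀ x y i, i ∉ Set.range pos → G x i = G y i := by
    intro x y i hi
    obtain ⟨j, hj, hj'⟩ := hpos.exists_le_lt_succ (hpos0.le.trans (Nat.zero_le i))
    have hne : pos j ≠ i := fun h => hi ⟨j, h⟩
    rw [hGv x j i (by omega) hj', hGv y j i (by omega) hj']
  have hst : ∀ j, (st (j + 1)).2.2 = (A j).image fun a => splice (pos j + 1) a (v j) :=
    fun _ => rfl
  have hAmem : ∀ x, (∀ i, x i ∈ F i) → ∀ j, s x j ∈ (st j).2.2 →
      Function.update (s x j) (pos j) (x j) ∈ A j := by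
    intro x hx j h
    exact Finset.mem_image.2 ⟨(s x j, x j), Finset.mem_product.2 ⟨h, hx j⟩, rfl⟩
  have hsmem : ∀ x, (∀ i, x i ∈ F i) → ∀ j, s x j ∈ (st j).2.2 := by
    intro x hx j
    induction j with
    | zero => exact Finset.mem_singleton_self _
    | succ j ih =>
      rw [hst, hs_succ]
      exact Finset.mem_image_of_mem _ (hAmem x hx j ih)
  have hGsplice : ∀ x, (∀ i, x i ∈ F i) → ∀ j, ∃ a ∈ A j, ∀ z : ℕ → Q,
      (∀ i ≥ pos j + 1, z i = G x i) → G x = splice (pos j + 1) a z := by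
    intro x hx j
    refine ⟨_, hAmem x hx j (hsmem x hx j), fun z hz => funext fun i => ?_⟩
    rcases lt_or_ge i (pos j + 1) with h | h
    · rw [splice_of_lt _ _ h]
      rcases Nat.lt_succ_iff_lt_or_eq.1 h with h' | rfl
      · rw [Function.update_of_ne h'.ne, hG x j i h']
      · rw [Function.update_self, hGpos]
    · rw [splice_of_le _ _ h, hz i h]
  have hGC : ∀ x, (∀ i, x i ∈ F i) → G x ∈ ⋂ i, O i := by
    intro x hx
    refine Set.mem_iInter.2 fun j => ?_
    obtain ⟨a, ha, hax⟩ := hGsplice x hx j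
    rw [hax (G x) fun _ _ => rfl]
    exact h1 j (pos j) (L j) (A j) a ha (G x) (hGv x j)
  -- The shift occurs because the bound belonging to coordinate `j` is produced only after that
  -- coordinate has been filled.
  refine ⟨pos, fun j => L (j + 1), G, hpos, fun i j hij => hL (Nat.succ_lt_succ hij), hGpos,
    hGrange, ?_, ?_⟩
  · intro x y hx hy j hxy m hm m' hm'
    obtain ⟨a, ha, hax⟩ := hGsplice x hx j
    obtain ⟨b, hb, hby⟩ := hGsplice y hy j
    have hGxy : ∀ i ≥ pos j + 1, G x i = G y i := by
      intro i hi
      by_cases hr : i ∈ Set.range pos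
      · obtain ⟨k, rfl⟩ := hr
        rw [hGpos, hGpos, hxy k (hpos.lt_iff_lt.1 (by omega))]
      · exact hGrange x y i hr
    have ex := hax (G x) fun _ _ => rfl
    have ey := hby (G x) hGxy
    have hcx := hGC x hx
    have hcy := hGC y hy
    rw [ex] at hcx
    rw [ey] at hcy
    have := h2 j (pos j) (L j) (A j) a ha b hb (G x) (hGv x j) hcx hcy m hm m' hm'
    rwa [← ex, ← ey] at this
  · intro x y hx hy j hxy m hm
    obtain ⟨a, ha, hax⟩ := hGsplice x hx j
    have hGxy : ∀ i < pos j + 1, G x i = G y i := by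
      intro i hi
      by_cases hr : i ∈ Set.range pos
      · obtain ⟨k, rfl⟩ := hr
        rw [hGpos, hGpos, hxy k (hpos.le_iff_le.1 (by omega))]
      · exact hGrange x y i hr
    have ex := hax (G x) fun _ _ => rfl
    have ey : G y = splice (pos j + 1) a (G y) := by
      funext i
      rcases lt_or_ge i (pos j + 1) with h | h
      · rw [splice_of_lt _ _ h, ← hGxy i h]
        conv_lhs => rw [ex]
        exact splice_of_lt _ _ h
      · rw [splice_of_le _ _ h]
    have hcx := hGC x hx
    have hcy := hGC y hy
    rw [ex] at hcx
    rw [ey] at hcy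
    have := h3 j (pos j) (L j) (A j) a ha (G x) (G y) (hGv x j) (hGv y j) hcx hcy m hm
    rwa [← ex, ← ey] at this

end Baire

/-! ### Convergence of series along subsequences and in consecutive blocks -/

section Sums

variable {M : Type*} [AddCommGroup M] [TopologicalSpace M] [IsTopologicalAddGroup M]

theorem Filter.Tendsto.exists_forall_sub_mem {S : ℕ → M} {l : M} (h : Tendsto S atTop (𝓝 l))
    {U : Set M} (hU : U ∈ 𝓝 0) : ∃ K, ∀ i ≥ K, ∀ j ≥ K, S i - S j ∈ U := by
  have : Tendsto (fun p : ℕ × ℕ => S p.1 - S p.2) (atTop ×ˢ atTop) (𝓝 0) := by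
    simpa using (h.comp tendsto_fst).sub (h.comp tendsto_snd)
  rw [prod_atTop_atTop_eq] at this
  obtain ⟨⟨a, b⟩, hab⟩ := mem_atTop_sets.1 (this hU)
  exact ⟨max a b, fun i hi j hj => hab (i, j)
    ⟨(le_max_left a b).trans hi, (le_max_right a b).trans hj⟩⟩

/-- A sequence converges if it does so along `a` and varies little between consecutive
values of `a`. -/
theorem tendsto_of_tendsto_comp_strictMono {S : ℕ → M} {a : ℕ → ℕ} (ha : StrictMono a) {l : M}
    (h : Tendsto (fun r => S (a r)) atTop (𝓝 l))
    (hS : ∀ U ∈ 𝓝 (0 : M), ∀ᶠ r in atTop, ∀ n, a r ≤ n → n < a (r + 1) → S n - S (a r) ∈ U) :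
    Tendsto S atTop (𝓝 l) := by
  have hex : ∀ n, ∃ r, a 0 ≤ n → a r ≤ n ∧ n < a (r + 1) := by
    intro n
    by_cases hn : a 0 ≤ n
    · obtain ⟨r, hr⟩ := ha.exists_le_lt_succ hn
      exact ⟨r, fun _ => hr⟩
    · exact ⟨0, fun h => absurd h hn⟩
  choose r hr using hex
  have hrt : Tendsto r atTop atTop := by
    refine tendsto_atTop.2 fun R => ?_
    filter_upwards [eventually_ge_atTop (a R), eventually_ge_atTop (a 0)] with n hn hn0
    have := (hr n hn0).2
    exact Nat.lt_succ_iff.1 (ha.lt_iff_lt.1 (hn.trans_lt this))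
  have h1 : Tendsto (fun n => S n - S (a (r n))) atTop (𝓝 0) := by
    intro U hU
    change ∀ᶠ n in atTop, S n - S (a (r n)) ∈ U
    filter_upwards [hrt.eventually (hS U hU), eventually_ge_atTop (a 0)] with n hn hn0
    exact hn n (hr n hn0).1 (hr n hn0).2
  simpa using h1.add (h.comp hrt)

omit [TopologicalSpace M] [IsTopologicalAddGroup M] in
theorem sum_range_strictMono {pos : ℕ → ℕ} (hpos : StrictMono pos) {w : ℕ → M}
    (hw : ∀ i, i ∉ Set.range pos → w i = 0) (j : ℕ) :
    ∑ i ∈ Finset.range (pos j), w i = ∑ k ∈ Finset.range j, w (pos k) := by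
  induction j with
  | zero =>
    refine Finset.sum_eq_zero fun i hi => hw i ?_
    rintro ⟨k, rfl⟩
    exact absurd (Finset.mem_range.1 hi) (hpos.monotone (Nat.zero_le k)).not_gt
  | succ j ih =>
    have hlt := hpos (Nat.lt_succ_self j)
    have hIco : ∑ i ∈ Finset.Ico (pos j) (pos (j + 1)), w i = w (pos j) := by
      refine Finset.sum_eq_single (pos j) (fun i hi hij => ?_) fun h => ?_
      · rw [Finset.mem_Ico] at hi
        refine hw i ?_
        rintro ⟨k, rfl⟩
        have h1 := hpos.le_iff_le.1 hi.1
        have h2 := hpos.lt_iff_lt.1 hi.2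
        exact hij (by congr 1; omega)
      · exact absurd (Finset.mem_Ico.2 ⟨le_rfl, hlt⟩) h
    rw [← Finset.sum_range_add_sum_Ico _ hlt.le, ih, Finset.sum_range_succ, hIco]

/-- Inserting zeros is harmless: between `pos r` and `pos (r + 1)` the partial sum changes by at
most the single term at `pos r`. -/
theorem tendsto_sum_range_strictMono_iff {pos : ℕ → ℕ} (hpos : StrictMono pos) {w : ℕ → M}
    (hw : ∀ i, i ∉ Set.range pos → w i = 0) (l : M) :
    Tendsto (fun n => ∑ i ∈ Finset.range n, w i) atTop (𝓝 l) ↔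
      Tendsto (fun n => ∑ k ∈ Finset.range n, w (pos k)) atTop (𝓝 l) := by
  constructor
  · intro h
    exact (h.comp hpos.tendsto_atTop).congr fun n => sum_range_strictMono hpos hw n
  · intro h
    refine tendsto_of_tendsto_comp_strictMono hpos
      (h.congr fun n => (sum_range_strictMono hpos hw n).symm) fun U hU => ?_
    obtain ⟨K, hK⟩ := h.exists_forall_sub_mem hU
    filter_upwards [eventually_ge_atTop K] with r hr n hn hn'
    have h0 : ∑ i ∈ Finset.range n, w i - ∑ i ∈ Finset.range (pos r), w i =
        ∑ i ∈ Finset.Ico (pos r) n, w i := by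
      rw [← Finset.sum_range_add_sum_Ico _ hn, add_sub_cancel_left]
    rw [h0]
    rcases hn.eq_or_lt with rfl | hlt
    · simpa using mem_of_mem_nhds hU
    · rw [Finset.sum_eq_single (pos r)]
      · simpa [Finset.sum_range_succ] using hK (r + 1) (by omega) r hr
      · intro i hi hir
        rw [Finset.mem_Ico] at hi
        refine hw i ?_
        rintro ⟨k, rfl⟩
        have h1 := hpos.le_iff_le.1 hi.1
        have h2 := hpos.lt_iff_lt.1 (hi.2.trans hn')
        exact hir (by congr 1; omega)
      · intro h
        exact absurd (Finset.mem_Ico.2 ⟨le_rfl, hlt⟩) h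

end Sums

section Concat

variable {Q : Type*} [AddCommGroup Q]

/-- The sequence `x` vanishes off `[a, b)`. -/
def SupportedOn (x : ℕ → Q) (a b : ℕ) : Prop := ∀ i, i < a ∨ b ≤ i → x i = 0

/-- The pointwise sum of blocks `x r`, of which the `r`-th is meant to be supported on
`[a r, a (r + 1))` for a strictly increasing sequence `a`. -/
def concat (x : ℕ → ℕ → Q) : ℕ → Q := fun i => ∑ r ∈ Finset.range (i + 1), x r i

variable {a : ℕ → ℕ} {x : ℕ → ℕ → Q}

theorem concat_eq (ha : StrictMono a) (hx : ∀ r, SupportedOn (x r) (a r) (a (r + 1)))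
    {r i : ℕ} (h : a r ≤ i) (h' : i < a (r + 1)) : concat x i = x r i := by
  refine Finset.sum_eq_single r (fun s _ hsr => ?_) fun hr => ?_
  · rcases lt_or_gt_of_ne hsr with hs | hs
    · exact hx s i (Or.inr ((ha.monotone hs).trans h))
    · exact hx s i (Or.inl (h'.trans_le (ha.monotone hs)))
  · have := ha.le_apply (x := r)
    exact absurd (Finset.mem_range.2 (by omega)) hr

theorem concat_eq_zero (ha : StrictMono a) (hx : ∀ r, SupportedOn (x r) (a r) (a (r + 1)))
    {i : ℕ} (h : i < a 0) : concat x i = 0 :=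
  Finset.sum_eq_zero fun s _ => hx s i (Or.inl (h.trans_le (ha.monotone (Nat.zero_le s))))

theorem concat_mem (ha : StrictMono a) (hx : ∀ r, SupportedOn (x r) (a r) (a (r + 1)))
    {F : ℕ → Finset Q} (h0 : ∀ i, 0 ∈ F i) (hF : ∀ r i, x r i ∈ F i) (i : ℕ) :
    concat x i ∈ F i := by
  rcases lt_or_ge i (a 0) with h | h
  · rw [concat_eq_zero ha hx h]; exact h0 i
  · obtain ⟨r, hr, hr'⟩ := ha.exists_le_lt_succ h
    rw [concat_eq ha hx hr hr']; exact hF r i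

variable {M : Type*} [AddCommGroup M] {ψ : ℕ → Q → M}

/-- No additivity of `ψ i` is needed: the blocks have disjoint supports, so each index sees only one
of them. -/
theorem sum_concat_add (ha : StrictMono a) (hx : ∀ r, SupportedOn (x r) (a r) (a (r + 1)))
    (hψ : ∀ i, ψ i 0 = 0) {r n : ℕ} (h : a r ≤ n) (h' : n ≤ a (r + 1)) :
    ∑ i ∈ Finset.range n, ψ i (concat x i) =
      ∑ i ∈ Finset.range (a r), ψ i (concat x i) + ∑ i ∈ Finset.range n, ψ i (x r i) := by
  induction n, h using Nat.le_induction with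
  | base =>
    rw [left_eq_add]
    refine Finset.sum_eq_zero fun i hi => ?_
    rw [hx r i (Or.inl (Finset.mem_range.1 hi)), hψ]
  | succ n hn ih =>
    rw [Finset.sum_range_succ, ih (by omega), Finset.sum_range_succ,
      concat_eq ha hx hn (by omega), add_assoc]

theorem sum_concat (ha : StrictMono a) (hx : ∀ r, SupportedOn (x r) (a r) (a (r + 1)))
    (hψ : ∀ i, ψ i 0 = 0) (r : ℕ) :
    ∑ i ∈ Finset.range (a r), ψ i (concat x i) =
      ∑ s ∈ Finset.range r, ∑ i ∈ Finset.range (a (s + 1)), ψ i (x s i) := by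
  induction r with
  | zero =>
    refine Finset.sum_eq_zero fun i hi => ?_
    rw [concat_eq_zero ha hx (Finset.mem_range.1 hi), hψ]
  | succ r ih =>
    rw [sum_concat_add ha hx hψ (ha (Nat.lt_succ_self r)).le le_rfl, ih, Finset.sum_range_succ]

variable [TopologicalSpace M] [IsTopologicalAddGroup M]

theorem tendsto_sum_concat (ha : StrictMono a) (hx : ∀ r, SupportedOn (x r) (a r) (a (r + 1)))
    (hψ : ∀ i, ψ i 0 = 0) {l : M}
    (htot : Tendsto (fun r => ∑ s ∈ Finset.range r, ∑ i ∈ Finset.range (a (s + 1)), ψ i (x s i))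
      atTop (𝓝 l))
    (hin : ∀ U ∈ 𝓝 (0 : M), ∀ᶠ r in atTop, ∀ n, a r ≤ n → n < a (r + 1) →
      ∑ i ∈ Finset.range n, ψ i (x r i) ∈ U) :
    Tendsto (fun n => ∑ i ∈ Finset.range n, ψ i (concat x i)) atTop (𝓝 l) := by
  refine tendsto_of_tendsto_comp_strictMono ha
    (htot.congr fun r => (sum_concat ha hx hψ r).symm) fun U hU => ?_
  filter_upwards [hin U hU] with r hr n hn hn'
  rw [sum_concat_add ha hx hψ hn hn'.le, add_sub_cancel_left]
  exact hr n hn hn'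

theorem tendsto_sum_concat_zero (ha : StrictMono a)
    (hx : ∀ r, SupportedOn (x r) (a r) (a (r + 1)))
    (hψ : ∀ i, ψ i 0 = 0) (htot : ∀ r, ∑ i ∈ Finset.range (a (r + 1)), ψ i (x r i) = 0)
    (hin : ∀ U ∈ 𝓝 (0 : M), ∀ᶠ r in atTop, ∀ n, a r ≤ n → n < a (r + 1) →
      ∑ i ∈ Finset.range n, ψ i (x r i) ∈ U) :
    Tendsto (fun n => ∑ i ∈ Finset.range n, ψ i (concat x i)) atTop (𝓝 0) :=
  tendsto_sum_concat ha hx hψ (by simp [htot, tendsto_const_nhds]) hin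

/-- The Cauchy criterion in blocks; it is what contradicts the gluing of infinitely many bad blocks
into a convergent series. -/
theorem eventually_block_sum_mem (ha : StrictMono a)
    (hx : ∀ r, SupportedOn (x r) (a r) (a (r + 1))) (hψ : ∀ i, ψ i 0 = 0) {l : M}
    (h : Tendsto (fun n => ∑ i ∈ Finset.range n, ψ i (concat x i)) atTop (𝓝 l))
    {U : Set M} (hU : U ∈ 𝓝 0) :
    ∀ᶠ r in atTop, ∀ n, a r ≤ n → n ≤ a (r + 1) → ∑ i ∈ Finset.range n, ψ i (x r i) ∈ U := by
  obtain ⟨K, hK⟩ := h.exists_forall_sub_mem hU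
  filter_upwards [eventually_ge_atTop K] with r hr n hn hn'
  have hra := ha.le_apply (x := r)
  have := hK n (by omega) (a r) (by omega)
  rwa [sum_concat_add ha hx hψ hn hn', add_sub_cancel_left] at this

-- Recursive choice with each block starting where the previous one ends, used to glue
-- counterexamples.
omit [AddCommGroup Q] in
theorem exists_blocks {P : ℕ → ℕ → (ℕ → Q) → ℕ → Prop}
    (h : ∀ r k, ∃ x b, k < b ∧ P r k x b) (k₀ : ℕ) :
    ∃ (a : ℕ → ℕ) (x : ℕ → ℕ → Q), StrictMono a ∧ a 0 = k₀ ∧ ∀ r, P r (a r) (x r) (a (r + 1)) := by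
  choose X B hB hP using h
  let a : ℕ → ℕ := fun r => Nat.rec k₀ (fun r k => B r k) r
  exact ⟨a, fun r => X r (a r), strictMono_nat_of_lt_succ fun r => hB r (a r),
    rfl, fun r => hP r (a r)⟩

end Concat

/-! ### Complete gauges of seminorms and series reductions -/

/-- An increasing sequence of group seminorms which generates the topology of `Y` and is
complete. -/
structure IsCompleteGauge {Y : Type*} [AddCommGroup Y] [TopologicalSpace Y]
    (q : ℕ → AddGroupSeminorm Y) : Prop where
  le_succ : ∀ n y, q n y ≤ q (n + 1) y
  mem_nhds_zero_iff : ∀ U : Set Y, U ∈ 𝓝 0 ↔ ∃ n, ∃ ε > 0, ∀ y, q n y < ε → y ∈ U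
  complete : ∀ u : ℕ → Y, (∀ n, ∀ ε > 0, ∃ K, ∀ i ≥ K, ∀ j ≥ K, q n (u i - u j) < ε) →
    ∃ l, Tendsto u atTop (𝓝 l)

namespace IsCompleteGauge

variable {Y : Type*} [AddCommGroup Y] [TopologicalSpace Y] {q : ℕ → AddGroupSeminorm Y}
  (hq : IsCompleteGauge q)

include hq

theorem mono {m n : ℕ} (h : m ≤ n) (y : Y) : q m y ≤ q n y :=
  monotone_nat_of_le_succ (f := fun n => q n y) (fun n => hq.le_succ n y) h

theorem setOf_lt_mem (n : ℕ) {ε : ℝ} (hε : 0 < ε) : {y | q n y < ε} ∈ 𝓝 (0 : Y) :=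
  (hq.mem_nhds_zero_iff _).2 ⟨n, ε, hε, fun _ h => h⟩

theorem continuous [IsTopologicalAddGroup Y] (n : ℕ) : Continuous (q n) := by
  rw [continuous_iff_continuousAt]
  intro y
  rw [ContinuousAt, Metric.tendsto_nhds]
  intro ε hε
  have h : Tendsto (fun z => z - y) (𝓝 y) (𝓝 0) := by
    simpa using (continuous_sub_right y).tendsto y
  filter_upwards [h (hq.setOf_lt_mem n hε)] with z hz
  exact (abs_sub_map_le_sub (q n) z y).trans_lt hz

/-- For a fixed `q n`, monotonicity of the gauge bounds every term from index `n` on by a geometric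
one; earlier terms do not affect convergence. -/
theorem exists_tendsto_sum {e : ℕ → Y} {C : ℝ} (he : ∀ k, q k (e k) ≤ C * (1 / 2) ^ k) :
    ∃ l, Tendsto (fun n => ∑ k ∈ Finset.range n, e k) atTop (𝓝 l) := by
  refine hq.complete _ fun n ε hε => ?_
  have hT : Summable fun k : ℕ => C * (1 / 2 : ℝ) ^ k := summable_geometric_two.mul_left C
  have hc := hT.hasSum.tendsto_sum_nat.cauchySeq
  rw [Metric.cauchySeq_iff] at hc
  obtain ⟨K, hK⟩ := hc ε hε
  have key : ∀ i ≥ n, ∀ j ≥ i, q n (∑ k ∈ Finset.range j, e k - ∑ k ∈ Finset.range i, e k) ≤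
      ∑ k ∈ Finset.range j, C * (1 / 2 : ℝ) ^ k - ∑ k ∈ Finset.range i, C * (1 / 2 : ℝ) ^ k := by
    intro i hi j hj
    induction j, hj using Nat.le_induction with
    | base => simp
    | succ j hj ih =>
      rw [Finset.sum_range_succ, Finset.sum_range_succ, add_sub_right_comm, add_sub_right_comm]
      refine (map_add_le_add (q n) _ _).trans (add_le_add ih ?_)
      exact (hq.mono (hi.trans hj) _).trans (he j)
  refine ⟨max K n, fun i hi j hj => ?_⟩
  rcases le_total i j with h | h
  · rw [map_sub_rev]
    refine (key i ((le_max_right _ _).trans hi) j h).trans_lt ((le_abs_self _).trans_lt ?_)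
    exact hK j ((le_max_left _ _).trans hj) i ((le_max_left _ _).trans hi)
  · refine (key j ((le_max_right _ _).trans hj) i h).trans_lt ((le_abs_self _).trans_lt ?_)
    exact hK i ((le_max_left _ _).trans hi) j ((le_max_left _ _).trans hj)

end IsCompleteGauge

/-- Maps `φ i` from finite subsets `F i` of `Q` to `Y`, such that the series `∑ ι (x i)` converges
if and only if `∑ φ i (x i)` does, for the sequences `x` with `x i ∈ F i` and `ι (x i) → 0`. -/
structure IsSeriesReduction {X Y Q : Type*} [AddCommGroup X] [TopologicalSpace X]
    [AddCommGroup Y] [TopologicalSpace Y] [AddCommGroup Q] (ι : Q →+ X) (F : ℕ → Finset Q)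
    (φ : ℕ → Q → Y) : Prop where
  zero_mem : ∀ i, 0 ∈ F i
  neg_mem : ∀ i g, g ∈ F i → -g ∈ F i
  mono : Monotone F
  exists_mem : ∀ g, ∃ i, g ∈ F i
  apply_zero : ∀ i, φ i 0 = 0
  convergent : ∀ x : ℕ → Q, (∀ i, x i ∈ F i) →
    (∃ l, Tendsto (fun n => ∑ i ∈ Finset.range n, ι (x i)) atTop (𝓝 l)) →
    ∃ l, Tendsto (fun n => ∑ i ∈ Finset.range n, φ i (x i)) atTop (𝓝 l)
  convergent_of : ∀ x : ℕ → Q, (∀ i, x i ∈ F i) → Tendsto (fun i => ι (x i)) atTop (𝓝 0) →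
    (∃ l, Tendsto (fun n => ∑ i ∈ Finset.range n, φ i (x i)) atTop (𝓝 l)) →
    ∃ l, Tendsto (fun n => ∑ i ∈ Finset.range n, ι (x i)) atTop (𝓝 l)

/-- Finiteness serves the Baire construction, which handles finitely many strings per stage;
symmetry and monotonicity allow a step to be undone later. -/
theorem exists_finite_exhaustion (Q : Type*) [AddCommGroup Q] [Countable Q] :
    ∃ F : ℕ → Finset Q, (∀ i, 0 ∈ F i) ∧ (∀ i g, g ∈ F i → -g ∈ F i) ∧ Monotone F ∧
      ∀ g, ∃ i, g ∈ F i := by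
  classical
  obtain ⟨e, he⟩ := exists_surjective_nat Q
  refine ⟨fun i => insert 0 ((Finset.range i).image e ∪ (Finset.range i).image fun k => -e k),
    fun i => Finset.mem_insert_self _ _, ?_, ?_, ?_⟩
  · intro i g hg
    simp only [Finset.mem_insert, Finset.mem_union, Finset.mem_image] at hg ⊢
    rcases hg with rfl | ⟨k, hk, rfl⟩ | ⟨k, hk, rfl⟩
    · simp
    · exact Or.inr (Or.inr ⟨k, hk, rfl⟩)
    · exact Or.inr (Or.inl ⟨k, hk, (neg_neg _).symm⟩)
  · intro i j hij
    exact Finset.insert_subset_insert _ (Finset.union_subset_union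
      (Finset.image_subset_image (Finset.range_mono hij))
      (Finset.image_subset_image (Finset.range_mono hij)))
  · intro g
    obtain ⟨k, rfl⟩ := he g
    refine ⟨k + 1, ?_⟩
    simp only [Finset.mem_insert, Finset.mem_union, Finset.mem_image]
    exact Or.inr (Or.inl ⟨k, Finset.self_mem_range_succ k, rfl⟩)

/-! ### From almost additive maps to coordinatewise ones -/

section AlmostAdditive

variable {X Y Q : Type*} [AddCommGroup X] [TopologicalSpace X] [IsTopologicalAddGroup X]
  [AddCommGroup Y] [TopologicalSpace Y] [AddCommGroup Q]
  {q : ℕ → AddGroupSeminorm Y} {F : ℕ → Finset Q} {D : (ℕ → Q) → ℕ → Y} {L : ℕ → ℕ}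

theorem single_mem (h0 : ∀ i, 0 ∈ F i) {j : ℕ} {c : Q} (hc : c ∈ F j) (i : ℕ) :
    (Pi.single j c : ℕ → Q) i ∈ F i := by
  rcases eq_or_ne i j with rfl | h
  · simpa using hc
  · simpa [Pi.single_eq_of_ne h] using h0 i

/-- Within the block `[L j, L (j + 1)]` the increments of `D x` are almost determined by the
coordinate `x (j + 1)`. -/
theorem almost_additive_block (hq : IsCompleteGauge q) (h0 : ∀ i, 0 ∈ F i)
    (hD0 : ∀ m, D 0 m = 0) (hL : StrictMono L)
    (hD1 : ∀ x y, (∀ i, x i ∈ F i) → (∀ i, y i ∈ F i) → ∀ j, (∀ i > j, x i = y i) →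
        ∀ m ≥ L j, ∀ m' ≥ L j, q j ((D x m - D y m) - (D x m' - D y m')) ≤ (1 / 2) ^ j)
    (hD2 : ∀ x y, (∀ i, x i ∈ F i) → (∀ i, y i ∈ F i) → ∀ j, (∀ i ≤ j, x i = y i) →
        ∀ m ≤ L j, q j (D x m - D y m) ≤ (1 / 2) ^ j)
    {x : ℕ → Q} (hx : ∀ i, x i ∈ F i) {j m : ℕ} (hm : L j ≤ m) (hm' : m ≤ L (j + 1)) :
    q j (D x m - D x (L j) - D (Pi.single (j + 1) (x (j + 1))) m) ≤ 4 * (1 / 2) ^ j := by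
  set s : ℕ → Q := Pi.single (j + 1) (x (j + 1)) with hs
  -- Truncating `x` after `j + 1` hardly changes `D` up to `L (j + 1)`. Then `t` and `s` agree
  -- beyond `j`, so their increments after `L j` nearly agree, and `D s (L j)` is nearly `D 0 (L j)
  -- = 0`.
  set t : ℕ → Q := fun i => if i ≤ j + 1 then x i else 0 with ht
  have hsF : ∀ i, s i ∈ F i := single_mem h0 (hx _)
  have htF : ∀ i, t i ∈ F i := by
    intro i
    by_cases h : i ≤ j + 1
    · simpa [ht, h] using hx i
    · simpa [ht, h] using h0 i
  have hxt : ∀ i ≤ j + 1, x i = t i := fun i hi => by simp [ht, hi]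
  have hLj := hL (Nat.lt_succ_self j)
  have e1 := hD2 x t hx htF (j + 1) hxt m hm'
  have e2 := hD2 x t hx htF (j + 1) hxt (L j) hLj.le
  have e3 := hD1 t s htF hsF j (fun i hi => by
    rcases Nat.lt_or_ge (j + 1) i with h | h
    · simp [ht, hs, h.not_ge, Pi.single_eq_of_ne h.ne']
    · obtain rfl : i = j + 1 := by omega
      simp [ht, hs]) m hm (L j) le_rfl
  have e4 := hD2 s 0 hsF (fun i => h0 i) j (fun i hi => by
    simp [hs, Pi.single_eq_of_ne (show i ≠ j + 1 by omega)]) (L j) le_rfl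
  rw [hD0, sub_zero] at e4
  have key : D x m - D x (L j) - D s m =
      (D x m - D t m) - (D x (L j) - D t (L j)) +
        ((D t m - D s m) - (D t (L j) - D s (L j)) - D s (L j)) := by abel
  have hhalf : (1 / 2 : ℝ) ^ (j + 1) = (1 / 2) ^ j / 2 := by rw [pow_succ]; ring
  have hle := hq.mono (Nat.le_succ j)
  rw [key]
  have b1 := map_add_le_add (q j) ((D x m - D t m) - (D x (L j) - D t (L j)))
    ((D t m - D s m) - (D t (L j) - D s (L j)) - D s (L j))
  have b2 := map_sub_le_add (q j) (D x m - D t m) (D x (L j) - D t (L j))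
  have b3 := map_sub_le_add (q j) ((D t m - D s m) - (D t (L j) - D s (L j))) (D s (L j))
  have b4 := hle (D x m - D t m)
  have b5 := hle (D x (L j) - D t (L j))
  have hp : (0 : ℝ) < (1 / 2) ^ j := by positivity
  rw [Nat.succ_eq_add_one] at b4 b5
  linarith

variable [IsTopologicalAddGroup Y]

/-- An almost additive reduction of convergence of series gives one of the form `φ i (x i)`. -/
theorem isSeriesReduction_of_almost_additive (ι : Q →+ X) (hq : IsCompleteGauge q)
    (h0 : ∀ i, 0 ∈ F i) (hneg : ∀ i g, g ∈ F i → -g ∈ F i) (hmono : Monotone F)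
    (hex : ∀ g, ∃ i, g ∈ F i) (hD0 : ∀ m, D 0 m = 0) (hL : StrictMono L)
    (hD1 : ∀ x y, (∀ i, x i ∈ F i) → (∀ i, y i ∈ F i) → ∀ j, (∀ i > j, x i = y i) →
        ∀ m ≥ L j, ∀ m' ≥ L j, q j ((D x m - D y m) - (D x m' - D y m')) ≤ (1 / 2) ^ j)
    (hD2 : ∀ x y, (∀ i, x i ∈ F i) → (∀ i, y i ∈ F i) → ∀ j, (∀ i ≤ j, x i = y i) →
        ∀ m ≤ L j, q j (D x m - D y m) ≤ (1 / 2) ^ j)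
    (hD3 : ∀ x : ℕ → Q, (∀ i, x i ∈ F i) →
      ((∃ l, Tendsto (fun n => ∑ i ∈ Finset.range n, ι (x i)) atTop (𝓝 l)) ↔
        ∃ l, Tendsto (D x) atTop (𝓝 l))) :
    IsSeriesReduction ι F fun j c => D (Pi.single j c) (L j) := by
  have hblock := fun (x : ℕ → Q) (hx : ∀ i, x i ∈ F i) (j m : ℕ) (hm : L j ≤ m)
    (hm' : m ≤ L (j + 1)) => almost_additive_block hq h0 hD0 hL hD1 hD2 hx hm hm'
  -- Telescoping over blocks leaves summable errors; the block starting at `L j` accounts for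
  -- coordinate `j + 1`, whence the range up to `n + 1`.
  have herr : ∀ x : ℕ → Q, (∀ i, x i ∈ F i) → ∃ l, Tendsto (fun n => D x (L n) -
      ∑ i ∈ Finset.range (n + 1), D (Pi.single i (x i)) (L i)) atTop (𝓝 l) := by
    intro x hx
    obtain ⟨l, hl⟩ := hq.exists_tendsto_sum (C := 4) fun k =>
      hblock x hx k (L (k + 1)) (hL (Nat.lt_succ_self k)).le le_rfl
    refine ⟨l + (D x (L 0) - D (Pi.single 0 (x 0)) (L 0)), ?_⟩
    refine (hl.add_const _).congr fun n => ?_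
    rw [Finset.sum_sub_distrib, Finset.sum_range_sub fun k => D x (L k),
      Finset.sum_range_succ' (fun i => D (Pi.single i (x i)) (L i))]
    abel
  have hiff : ∀ x : ℕ → Q, (∀ i, x i ∈ F i) →
      ((∃ l, Tendsto (fun n => ∑ i ∈ Finset.range n, D (Pi.single i (x i)) (L i)) atTop (𝓝 l)) ↔
        ∃ l, Tendsto (fun n => D x (L n)) atTop (𝓝 l)) := by
    intro x hx
    obtain ⟨l, hl⟩ := herr x hx
    constructor
    · rintro ⟨k, hk⟩
      exact ⟨l + k, by simpa using hl.add (hk.comp (tendsto_add_atTop_nat 1))⟩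
    · rintro ⟨k, hk⟩
      refine ⟨k - l, (tendsto_add_atTop_iff_nat 1).1 ?_⟩
      simpa using hk.sub hl
  -- Controls `D x` between the times `L j`. If it failed, following infinitely many bad `x (j + 1)`
  -- at once by their negatives would give a series converging to zero in `X`, while its `D` keeps
  -- oscillating inside blocks.
  have hinner : ∀ x : ℕ → Q, (∀ i, x i ∈ F i) → Tendsto (fun i => ι (x i)) atTop (𝓝 0) →
      ∀ n, ∀ ε > 0, ∀ᶠ j in atTop, ∀ m, L j ≤ m → m < L (j + 1) →
        q n (D (Pi.single (j + 1) (x (j + 1))) m) < ε := by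
    intro x hx hxι n ε hε
    by_contra hcon
    rw [not_eventually, frequently_atTop] at hcon
    obtain ⟨a, b, ha, -, hab⟩ := exists_blocks (P := fun r k y b => r ≤ k → ∃ j m, k ≤ j ∧
        L j ≤ m ∧ m < L (j + 1) ∧ ε ≤ q n (D (Pi.single (j + 1) (x (j + 1))) m) ∧
        y = (Pi.single (j + 1) (x (j + 1)) : ℕ → Q) +
          (Pi.single (j + 2) (-x (j + 1)) : ℕ → Q) ∧ b = j + 3) (by
      intro r k
      obtain ⟨j, hj, hj'⟩ := hcon k
      push Not at hj'
      obtain ⟨m, h1, h2, h3⟩ := hj'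
      exact ⟨(Pi.single (j + 1) (x (j + 1)) : ℕ → Q) +
        (Pi.single (j + 2) (-x (j + 1)) : ℕ → Q), j + 3, by omega,
        fun _ => ⟨j, m, hj, h1, h2, h3, rfl, rfl⟩⟩) 0
    have hab' := fun r => hab r ha.le_apply
    choose J m hJ hLm hmL hbad hb hJa using hab'
    have hbval : ∀ r i, b r i = if i = J r + 1 then x (J r + 1) else
        if i = J r + 2 then -x (J r + 1) else 0 := by
      intro r i
      rw [hb r, Pi.add_apply, Pi.single_apply, Pi.single_apply]
      split_ifs <;> first | omega | simp
    have hsupp : ∀ r, SupportedOn (b r) (a r) (a (r + 1)) := by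
      intro r i hi
      have h1 := hJ r
      have h2 := hJa r
      rw [hbval, if_neg (by omega), if_neg (by omega)]
    have hbF : ∀ r i, b r i ∈ F i := by
      intro r i
      rw [hbval]
      split_ifs with h1 h2
      · rw [h1]; exact hx _
      · rw [h2]; exact hneg _ _ (hmono (Nat.le_succ _) (hx _))
      · exact h0 i
    have hbsum : ∀ r k, ∑ i ∈ Finset.range k, ι (b r i) =
        if J r + 1 < k ∧ k ≤ J r + 2 then ι (x (J r + 1)) else 0 := by
      intro r k
      have : ∀ i, ι (b r i) = (if i = J r + 1 then ι (x (J r + 1)) else 0) +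
          if i = J r + 2 then -ι (x (J r + 1)) else 0 := by
        intro i
        rw [hbval]
        split_ifs <;> first | omega | simp
      simp only [this, Finset.sum_add_distrib, Finset.sum_ite_eq', Finset.mem_range]
      split_ifs <;> first | omega | simp
    have hJt : Tendsto J atTop atTop :=
      tendsto_atTop_mono (fun r => (ha.le_apply).trans (hJ r)) tendsto_id
    have hconv : Tendsto (fun k => ∑ i ∈ Finset.range k, ι (concat b i)) atTop (𝓝 0) := by
      refine tendsto_sum_concat_zero (ψ := fun _ => ι) ha hsupp (fun _ => map_zero ι) ?_ ?_
      · intro r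
        rw [hbsum, if_neg (by have := hJa r; omega)]
      · intro U hU
        have h1 : ∀ᶠ r in atTop, ι (x (J r + 1)) ∈ U :=
          (hxι.comp ((tendsto_add_atTop_nat 1).comp hJt)).eventually hU
        filter_upwards [h1] with r hr k _ _
        rw [hbsum]
        split_ifs
        · exact hr
        · exact mem_of_mem_nhds hU
    have hXF : ∀ i, concat b i ∈ F i := concat_mem ha hsupp h0 hbF
    obtain ⟨l, hl⟩ := (hD3 _ hXF).1 ⟨0, hconv⟩
    obtain ⟨K, hK⟩ := hl.exists_forall_sub_mem (hq.setOf_lt_mem n (half_pos hε))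
    have hsmall : ∀ᶠ j : ℕ in atTop, 4 * (1 / 2 : ℝ) ^ j < ε / 2 := by
      have : Tendsto (fun j : ℕ => 4 * (1 / 2 : ℝ) ^ j) atTop (𝓝 0) := by
        simpa using (tendsto_pow_atTop_nhds_zero_of_lt_one (r := (1 / 2 : ℝ))
          (by norm_num) (by norm_num)).const_mul 4
      exact this.eventually_lt_const (half_pos hε)
    obtain ⟨r, h1, h2, h3⟩ := (((hJt.eventually hsmall).and
      ((hJt.eventually (eventually_ge_atTop K)).and
        (hJt.eventually (eventually_ge_atTop n)))).exists)
    have hval : concat b (J r + 1) = x (J r + 1) := by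
      have e1 := hJ r
      have e2 := hJa r
      rw [concat_eq ha hsupp (r := r) (by omega) (by omega), hbval, if_pos rfl]
    have hest := hblock _ hXF (J r) (m r) (hLm r) (hmL r).le
    rw [hval] at hest
    have hLJ := hL.le_apply (x := J r)
    have hd : q n (D (concat b) (m r) - D (concat b) (L (J r))) < ε / 2 :=
      hK (m r) (by have := hLm r; omega) (L (J r)) (by omega)
    have := map_sub_le_add (q n) (D (concat b) (m r) - D (concat b) (L (J r)))
      (D (concat b) (m r) - D (concat b) (L (J r)) -
        D (Pi.single (J r + 1) (x (J r + 1))) (m r))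
    rw [sub_sub_cancel] at this
    have h4 := hq.mono h3 (D (concat b) (m r) - D (concat b) (L (J r)) -
        D (Pi.single (J r + 1) (x (J r + 1))) (m r))
    linarith [hbad r]
  refine ⟨h0, hneg, hmono, hex, fun i => by simp [hD0], ?_, ?_⟩
  · intro x hx hconv
    obtain ⟨l, hl⟩ := (hD3 x hx).1 hconv
    exact (hiff x hx).2 ⟨l, hl.comp hL.tendsto_atTop⟩
  · intro x hx hxι hconv
    obtain ⟨l, hl⟩ := (hiff x hx).1 hconv
    refine (hD3 x hx).2 ⟨l, tendsto_of_tendsto_comp_strictMono hL hl fun U hU => ?_⟩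
    obtain ⟨n, ε, hε, hU⟩ := (hq.mem_nhds_zero_iff U).1 hU
    have hsmall : ∀ᶠ j : ℕ in atTop, 4 * (1 / 2 : ℝ) ^ j < ε / 2 := by
      have : Tendsto (fun j : ℕ => 4 * (1 / 2 : ℝ) ^ j) atTop (𝓝 0) := by
        simpa using (tendsto_pow_atTop_nhds_zero_of_lt_one (r := (1 / 2 : ℝ))
          (by norm_num) (by norm_num)).const_mul 4
      exact this.eventually_lt_const (half_pos hε)
    filter_upwards [hinner x hx hxι n (ε / 2) (half_pos hε), hsmall, eventually_ge_atTop n]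
      with j h1 h2 h3 m hm hm'
    refine hU _ ?_
    have e1 := hblock x hx j m hm hm'.le
    have e2 := hq.mono h3 (D x m - D x (L j) - D (Pi.single (j + 1) (x (j + 1))) m)
    have e3 := map_add_le_add (q n) (D x m - D x (L j) - D (Pi.single (j + 1) (x (j + 1))) m)
      (D (Pi.single (j + 1) (x (j + 1))) m)
    rw [sub_add_cancel] at e3
    linarith [h1 m hm hm']

end AlmostAdditive

/-- A Borel reduction of `E(X)` to `E(Y)` yields a series reduction on every countable group of
`X`. -/
theorem exists_isSeriesReduction {X Y Q : Type*}
    [AddCommGroup X] [TopologicalSpace X] [IsTopologicalAddGroup X]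
    [AddCommGroup Y] [TopologicalSpace Y] [IsTopologicalAddGroup Y]
    [SecondCountableTopology Y] [AddCommGroup Q] [Countable Q] (ι : Q →+ X)
    {q : ℕ → AddGroupSeminorm Y} (hq : IsCompleteGauge q)
    (hred : BorelReducible (inducedRel (Multiplicative X)) (inducedRel (Multiplicative Y))) :
    ∃ F φ, IsSeriesReduction (Y := Y) ι F φ := by
  obtain ⟨f, hf, hfrel⟩ := hred
  let _ : TopologicalSpace Q := ⊥
  have : DiscreteTopology Q := ⟨rfl⟩
  -- With partial sums as codes, equivalence in `E(X)` becomes convergence of the series of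
  -- differences.
  let σ : (ℕ → Q) → ℕ → Multiplicative X := fun z n =>
    Multiplicative.ofAdd (∑ i ∈ Finset.range n, ι (z i))
  have hσ : Continuous σ := by
    refine continuous_pi fun n => ?_
    have : Continuous fun z : ℕ → Q => ∑ i ∈ Finset.range n, ι (z i) :=
      continuous_finsetSum _ fun i _ =>
        (continuous_of_discreteTopology (f := ι)).comp (continuous_apply i)
    exact this
  let θ : (ℕ → Q) → ℕ → Y := fun z m => (f (σ z) m).toAdd
  have hθm : @Measurable (ℕ → Q) (ℕ → Y) (borel _) (borel _) θ :=
    hf.comp hσ.borel_measurable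
  have hrel : ∀ z z' : ℕ → Q, (∃ l, Tendsto (fun n => ∑ i ∈ Finset.range n, (ι (z i) - ι (z' i)))
      atTop (𝓝 l)) ↔ ∃ l, Tendsto (fun m => θ z m - θ z' m) atTop (𝓝 l) := by
    intro z z'
    have h1 : ∀ n, (σ z n * (σ z' n)⁻¹).toAdd = ∑ i ∈ Finset.range n, (ι (z i) - ι (z' i)) := by
      intro n
      rw [toAdd_mul, toAdd_inv, Finset.sum_sub_distrib, sub_eq_add_neg]; rfl
    have h2 : ∀ m, (f (σ z) m * (f (σ z') m)⁻¹).toAdd = θ z m - θ z' m := by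
      intro m
      rw [toAdd_mul, toAdd_inv, sub_eq_add_neg]
    simp only [← h1, ← h2]
    exact hfrel (σ z) (σ z')
  obtain ⟨O, hO, hOd, hθ⟩ := exists_dense_continuousOn θ hθm
  have hfin : ∀ j n a a' z, ∀ ε > 0, ∃ K, ∀ m ≥ K, ∀ m' ≥ K,
      q j ((θ (splice n a z) m - θ (splice n a' z) m) -
        (θ (splice n a z) m' - θ (splice n a' z) m')) ≤ ε := by
    intro j n a a' z ε hε
    have hconst : ∀ i ≥ n, ∑ k ∈ Finset.range i, (ι (splice n a z k) - ι (splice n a' z k)) =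
        ∑ k ∈ Finset.range n, (ι (splice n a z k) - ι (splice n a' z k)) := fun i hi =>
      Finset.eventually_constant_sum
        (fun k hk => by rw [splice_of_le _ _ hk, splice_of_le _ _ hk, sub_self]) hi
    obtain ⟨l, hl⟩ := (hrel (splice n a z) (splice n a' z)).1
      ⟨_, tendsto_atTop_of_eventually_const hconst⟩
    obtain ⟨K, hK⟩ := hl.exists_forall_sub_mem (hq.setOf_lt_mem j hε)
    exact ⟨K, fun m hm m' hm' => (hK m hm m' hm').le⟩
  obtain ⟨F, h0, hneg, hmono, hex⟩ := exists_finite_exhaustion Q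
  obtain ⟨pos, L, G, hpos, hL, hGpos, hGrange, hP1, hP2⟩ :=
    exists_almost_additive_coding θ hO hOd hθ q hq.continuous hfin F
      (ε := fun j => (1 / 2) ^ j) fun j => by positivity
  -- Subtracting the base value at `G 0` makes `D 0 = 0`. As `G x` and `G 0` differ only at the
  -- positions `pos j`, their difference is `x` with zeros inserted.
  refine ⟨F, _, isSeriesReduction_of_almost_additive (q := q) (L := L)
    (D := fun x m => θ (G x) m - θ (G 0) m) ι hq h0 hneg hmono hex (fun m => sub_self _) hL
    ?_ ?_ ?_⟩
  · intro x y hx hy j hxy m hm m' hm'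
    simpa using hP1 x y hx hy j hxy m hm m' hm'
  · intro x y hx hy j hxy m hm
    simpa using hP2 x y hx hy j hxy m hm
  · intro x hx
    rw [← hrel]
    refine exists_congr fun l => ?_
    rw [tendsto_sum_range_strictMono_iff hpos (w := fun i => ι (G x i) - ι (G 0 i))
      (fun i hi => by rw [hGrange x 0 i hi, sub_self])]
    simp [hGpos]

/-! ### Images of paths and loops -/

section Paths

variable {X Y Q : Type*} [AddCommGroup X] [AddCommGroup Q]

/-- A finitely supported sequence `x` of elements of the `F i` whose partial sums are mapped
into `W` by `ι`. -/
structure IsPath (ι : Q →+ X) (F : ℕ → Finset Q) (W : Set X) (a b : ℕ) (x : ℕ → Q) : Prop where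
  mem : ∀ i, x i ∈ F i
  supp : SupportedOn x a b
  le : a ≤ b
  sum_mem : ∀ n, ∑ i ∈ Finset.range n, ι (x i) ∈ W

variable {ι : Q →+ X} {F : ℕ → Finset Q} {W : Set X} {a b : ℕ} {x : ℕ → Q}

theorem SupportedOn.mono (hx : SupportedOn x a b) {a' b' : ℕ} (ha : a' ≤ a) (hb : b ≤ b') :
    SupportedOn x a' b' := fun i hi => hx i (by omega)

theorem SupportedOn.sum_eq {M : Type*} [AddCommGroup M] {ψ : ℕ → Q → M} (hψ : ∀ i, ψ i 0 = 0)
    (hx : SupportedOn x a b) {n : ℕ} (hn : b ≤ n) :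
    ∑ i ∈ Finset.range n, ψ i (x i) = ∑ i ∈ Finset.range b, ψ i (x i) :=
  Finset.eventually_constant_sum (fun i hi => by rw [hx i (Or.inr hi), hψ]) hn

omit [AddCommGroup Q] in
theorem sum_range_update {M : Type*} [AddCommGroup M] (ψ : ℕ → Q → M) (e : ℕ) (t : Q) {n : ℕ}
    (hn : n ≤ e) : ∑ i ∈ Finset.range n, ψ i (Function.update x e t i) =
      ∑ i ∈ Finset.range n, ψ i (x i) :=
  Finset.sum_congr rfl fun i hi => by
    rw [Function.update_of_ne ((Finset.mem_range.1 hi).trans_le hn).ne]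

theorem SupportedOn.sum_update {M : Type*} [AddCommGroup M] {ψ : ℕ → Q → M}
    (hψ : ∀ i, ψ i 0 = 0) (hx : SupportedOn x a b) {e : ℕ} (he : b ≤ e) (t : Q) :
    ∑ i ∈ Finset.range (e + 1), ψ i (Function.update x e t i) =
      ∑ i ∈ Finset.range b, ψ i (x i) + ψ e t := by
  rw [Finset.sum_range_succ, sum_range_update ψ e t le_rfl, hx.sum_eq hψ he, Function.update_self]

theorem SupportedOn.update (hx : SupportedOn x a b) (hab : a ≤ b) {e : ℕ} (he : b ≤ e) (t : Q) :
    SupportedOn (Function.update x e t) a (e + 1) := by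
  intro i hi
  rw [Function.update_of_ne (by omega)]
  exact hx i (by omega)

theorem IsPath.update_sum (hx : IsPath ι F W a b x) {e : ℕ} (he : b ≤ e) (t : Q) (n : ℕ) :
    ∑ i ∈ Finset.range n, ι (Function.update x e t i) =
      if n ≤ e then ∑ i ∈ Finset.range n, ι (x i) else
        ∑ i ∈ Finset.range b, ι (x i) + ι t := by
  split_ifs with h
  · exact sum_range_update (fun _ => ι) e t h
  · rw [(hx.supp.update hx.le he t).sum_eq (ψ := fun _ => ι) (fun _ => map_zero ι) (by omega),
      hx.supp.sum_update (ψ := fun _ => ι) (fun _ => map_zero ι) he]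

theorem IsPath.update (hx : IsPath ι F W a b x) {e : ℕ} (he : b ≤ e) {t : Q} (ht : t ∈ F e)
    (hW : ι (∑ i ∈ Finset.range b, x i + t) ∈ W) :
    IsPath ι F W a (e + 1) (Function.update x e t) := by
  refine ⟨fun i => ?_, hx.supp.update hx.le he t, hx.le.trans (by omega), fun n => ?_⟩
  · rcases eq_or_ne i e with rfl | h
    · rwa [Function.update_self]
    · rw [Function.update_of_ne h]; exact hx.mem i
  · rw [hx.update_sum he]
    split_ifs
    · exact hx.sum_mem n
    · rwa [← map_sum, ← map_add]

theorem isPath_zero (h0 : ∀ i, 0 ∈ F i) (hW : (0 : X) ∈ W) (a : ℕ) :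
    IsPath ι F W a a (0 : ℕ → Q) :=
  ⟨fun i => h0 i, fun _ _ => rfl, le_rfl, fun n => by simpa using hW⟩

theorem isPath_single (h0 : ∀ i, 0 ∈ F i) (hW : (0 : X) ∈ W) {g : Q} {j : ℕ} (hg : g ∈ F j)
    (hgW : ι g ∈ W) : IsPath ι F W j (j + 1) (Pi.single j g) :=
  (isPath_zero h0 hW j).update le_rfl hg (by simpa using hgW)

variable [TopologicalSpace X] [IsTopologicalAddGroup X] [FirstCountableTopology X]
  [AddCommGroup Y] [TopologicalSpace Y] [IsTopologicalAddGroup Y] {φ : ℕ → Q → Y}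

/-- Paths with small partial sums have small images under `φ`. -/
theorem IsSeriesReduction.exists_nhds_path (h : IsSeriesReduction ι F φ) {U : Set Y}
    (hU : U ∈ 𝓝 0) : ∃ W ∈ 𝓝 (0 : X), ∃ K, ∀ a ≥ K, ∀ b x, IsPath ι F W a b x →
      ∑ i ∈ Finset.range b, φ i (x i) ∈ U := by
  obtain ⟨W, hW⟩ := (𝓝 (0 : X)).exists_antitone_basis
  by_contra! hcon
  -- Each bad path is closed up by one step back to zero, late enough to be admissible. The partial
  -- sums lie in the shrinking `W r`, so the glued series converges to zero.
  obtain ⟨a, y, ha, -, hay⟩ := exists_blocks (P := fun r k y e => ∃ b x, IsPath ι F (W r) k b x ∧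
      b + 1 ≤ e ∧ -∑ i ∈ Finset.range b, x i ∈ F (e - 1) ∧
      ∑ i ∈ Finset.range b, φ i (x i) ∉ U ∧
      y = Function.update x (e - 1) (-∑ i ∈ Finset.range b, x i)) (by
    intro r k
    obtain ⟨a, hak, b, x, hx, hxU⟩ := hcon (W r) (hW.mem r) k
    obtain ⟨e, he⟩ := h.exists_mem (-∑ i ∈ Finset.range b, x i)
    have hab := hx.le
    refine ⟨_, max b e + 1, by omega, b, x, ⟨hx.mem, hx.supp.mono hak le_rfl, by omega, hx.sum_mem⟩,
      by omega, ?_, hxU, rfl⟩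
    exact h.mono (by simp) he) 0
  choose b x hx hb hF hxU hy using hay
  have hpath : ∀ r, IsPath ι F (W r) (a r) (a (r + 1)) (y r) := by
    intro r
    have := (hx r).update (e := a (r + 1) - 1) (by have := hb r; omega) (hF r) (by
      rw [add_neg_cancel, map_zero]; exact mem_of_mem_nhds (hW.mem r))
    rw [hy r]
    rwa [Nat.sub_add_cancel (by have := hb r; omega)] at this
  have hsupp : ∀ r, SupportedOn (y r) (a r) (a (r + 1)) := fun r => (hpath r).supp
  have hconv : Tendsto (fun k => ∑ i ∈ Finset.range k, ι (concat y i)) atTop (𝓝 0) := by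
    refine tendsto_sum_concat_zero (ψ := fun _ => ι) ha hsupp (fun _ => map_zero ι) ?_ ?_
    · intro r
      rw [hy r, (hx r).update_sum (by have := hb r; omega), if_neg (by have := hb r; omega),
        map_neg, map_sum, add_neg_cancel]
    · intro V hV
      obtain ⟨R, hR⟩ := hW.mem_iff.1 hV
      filter_upwards [eventually_ge_atTop R] with r hr n _ _
      exact hR (hW.antitone hr ((hpath r).sum_mem n))
  obtain ⟨l, hl⟩ := h.convergent _ (concat_mem ha hsupp h.zero_mem fun r => (hpath r).mem)
    ⟨0, hconv⟩
  obtain ⟨r, hr⟩ := (eventually_block_sum_mem ha hsupp h.apply_zero hl hU).exists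
  refine hxU r ?_
  have := hr (b r) (hx r).le (by have := hb r; omega)
  rwa [hy r, sum_range_update φ _ _ (by have := hb r; omega)] at this

/-- A seminorm `p` has the finite sums property if a sequence whose finite sums all stay in a
certain neighbourhood of zero tends to zero for `p`. -/
def HasFiniteSumsProperty (p : AddGroupSeminorm Y) : Prop :=
  ∃ V ∈ 𝓝 (0 : Y), ∀ y : ℕ → Y, ¬ Tendsto (fun r => p (y r)) atTop (𝓝 0) →
    ∃ A : Finset ℕ, ∑ r ∈ A, y r ∉ V

/-- Closed paths in a fixed neighbourhood have small images if they start late enough. -/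
theorem IsSeriesReduction.exists_nhds_loop (h : IsSeriesReduction ι F φ) {p : AddGroupSeminorm Y}
    (hp : HasFiniteSumsProperty p) : ∃ W ∈ 𝓝 (0 : X), ∀ ε > 0, ∃ K, ∀ a ≥ K, ∀ b x,
      IsPath ι F W a b x → ∑ i ∈ Finset.range b, ι (x i) = 0 →
        p (∑ i ∈ Finset.range b, φ i (x i)) < ε := by
  classical
  obtain ⟨V, hV, hVp⟩ := hp
  obtain ⟨W, hW, K₀, hK₀⟩ := h.exists_nhds_path hV
  refine ⟨W, hW, fun ε hε => ?_⟩
  -- Choose consecutive loops with images at least `ε`, starting from `K₀`. Those selected by the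
  -- finite sums property form one path in `W`, since each returns to zero; its image is in `V` by
  -- `exists_nhds_path`, yet outside `V` by the selection.
  by_contra! hcon
  obtain ⟨a, x, ha, ha0, hax⟩ := exists_blocks (P := fun _ k x b => IsPath ι F W k b x ∧
      ∑ i ∈ Finset.range b, ι (x i) = 0 ∧ ε ≤ p (∑ i ∈ Finset.range b, φ i (x i))) (by
    intro r k
    obtain ⟨a, hak, b, x, hx, hx0, hxε⟩ := hcon k
    have hab := hx.le
    refine ⟨x, b + 1, by omega, ⟨hx.mem, hx.supp.mono hak (Nat.le_succ b), by omega, hx.sum_mem⟩,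
      ?_, ?_⟩
    · rwa [hx.supp.sum_eq (ψ := fun _ => ι) (fun _ => map_zero ι) (Nat.le_succ b)]
    · rwa [hx.supp.sum_eq h.apply_zero (Nat.le_succ b)]) K₀
  have hnot : ¬ Tendsto (fun r => p (∑ i ∈ Finset.range (a (r + 1)), φ i (x r i))) atTop (𝓝 0) := by
    intro ht
    obtain ⟨r, hr⟩ := (ht.eventually_lt_const hε).exists
    exact absurd (hax r).2.2 (not_le.2 hr)
  obtain ⟨A, hA⟩ := hVp _ hnot
  set z : ℕ → ℕ → Q := fun r => if r ∈ A then x r else 0 with hz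
  have hzsupp : ∀ r, SupportedOn (z r) (a r) (a (r + 1)) := by
    intro r i hi
    by_cases hr : r ∈ A
    · simpa [hz, hr] using (hax r).1.supp i hi
    · simp [hz, hr]
  obtain ⟨N, hN⟩ : ∃ N, A ⊆ Finset.range N := A.exists_nat_subset_range
  have hW0 : (0 : X) ∈ W := mem_of_mem_nhds hW
  have hztot : ∀ r, ∑ i ∈ Finset.range (a (r + 1)), ι (z r i) = 0 := by
    intro r
    by_cases hr : r ∈ A
    · simpa [hz, hr] using (hax r).2.1
    · simp [hz, hr]
  have hpath : IsPath ι F W (a 0) (a N) (concat z) := by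
    refine ⟨concat_mem ha hzsupp h.zero_mem fun r i => ?_, fun i hi => ?_,
      ha.monotone (Nat.zero_le N), fun n => ?_⟩
    · by_cases hr : r ∈ A
      · simpa [hz, hr] using (hax r).1.mem i
      · simpa [hz, hr] using h.zero_mem i
    · rcases lt_or_ge i (a 0) with h1 | h1
      · exact concat_eq_zero ha hzsupp h1
      · obtain ⟨r, hr, hr'⟩ := ha.exists_le_lt_succ h1
        rw [concat_eq ha hzsupp hr hr']
        have h2 : a N < a (r + 1) := by omega
        have h3 := ha.lt_iff_lt.1 h2
        have h4 : r ∉ A := fun hrA => by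
          have := Finset.mem_range.1 (hN hrA)
          omega
        simp [hz, h4]
    · rcases lt_or_ge n (a 0) with h1 | h1
      · rw [Finset.sum_eq_zero]
        · exact hW0
        · intro i hi
          rw [concat_eq_zero ha hzsupp ((Finset.mem_range.1 hi).trans h1), map_zero]
      · obtain ⟨r, hr, hr'⟩ := ha.exists_le_lt_succ h1
        rw [sum_concat_add (ψ := fun _ => ι) ha hzsupp (fun _ => map_zero ι) hr hr'.le,
          sum_concat (ψ := fun _ => ι) ha hzsupp (fun _ => map_zero ι),
          Finset.sum_eq_zero fun s _ => hztot s, zero_add]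
        by_cases hrA : r ∈ A
        · simpa [hz, hrA] using (hax r).1.sum_mem n
        · simpa [hz, hrA] using hW0
  refine hA ?_
  have hmem := hK₀ (a 0) ha0.ge (a N) _ hpath
  rw [sum_concat ha hzsupp h.apply_zero] at hmem
  have e : ∀ s, ∑ i ∈ Finset.range (a (s + 1)), φ i (z s i) =
      if s ∈ A then ∑ i ∈ Finset.range (a (s + 1)), φ i (x s i) else 0 := by
    intro s
    by_cases hs : s ∈ A
    · simp [hz, hs]
    · simp [hz, hs, h.apply_zero]
  simp only [e, Finset.sum_ite_mem, Finset.inter_eq_right.2 hN] at hmem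
  exact hmem

/-- A balanced neighbourhood of zero in which paths have nearly the same `φ`-image as a single
late step. -/
structure IsPathNhds [Module ℝ X] (ι : Q →+ X) (F : ℕ → Finset Q) (φ : ℕ → Q → Y)
    (p : AddGroupSeminorm Y) (W : Set X) : Prop where
  mem_nhds : W ∈ 𝓝 0
  balanced : Balanced ℝ W
  small : ∀ ε > 0, ∃ K, ∀ a ≥ K, ∀ b x, IsPath ι F W a b x → ∀ j ≥ b,
    -∑ i ∈ Finset.range b, x i ∈ F j →
      p (∑ i ∈ Finset.range b, φ i (x i) + φ j (-∑ i ∈ Finset.range b, x i)) < ε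

/-- A path followed by its late closing step is a loop, so `exists_nhds_loop` applies; shrinking to
a balanced neighbourhood preserves this. -/
theorem IsSeriesReduction.exists_isPathNhds [Module ℝ X] [ContinuousSMul ℝ X]
    (h : IsSeriesReduction ι F φ) {p : AddGroupSeminorm Y} (hp : HasFiniteSumsProperty p) :
    ∃ W, IsPathNhds ι F φ p W := by
  obtain ⟨W₀, hW₀, hloop⟩ := h.exists_nhds_loop hp
  obtain ⟨W, ⟨hW, hWb⟩, hWW₀⟩ := (nhds_basis_balanced ℝ X).mem_iff.1 hW₀
  refine ⟨W, hW, hWb, fun ε hε => ?_⟩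
  obtain ⟨K, hK⟩ := hloop ε hε
  refine ⟨K, fun a ha b x hx j hj hF => ?_⟩
  have hpath : IsPath ι F W₀ a (j + 1) (Function.update x j (-∑ i ∈ Finset.range b, x i)) := by
    have h1 := hx.update hj hF (by rw [add_neg_cancel, map_zero]; exact mem_of_mem_nhds hW)
    exact ⟨h1.mem, h1.supp, h1.le, fun n => hWW₀ (h1.sum_mem n)⟩
  have h2 := hK a ha _ _ hpath (by
    rw [hx.update_sum hj, if_neg (by omega), map_neg, map_sum, add_neg_cancel])
  rwa [hx.supp.sum_update h.apply_zero hj] at h2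

end Paths

/-! ### Straight walks and the limit homomorphism -/

section Window

variable {X Y Q : Type*} [AddCommGroup X] [AddCommGroup Y] [AddCommGroup Q]

/-- The sequence with the value `c` on `[p, p + M)` and `0` elsewhere. -/
def window (p M : ℕ) (c : Q) : ℕ → Q := fun i => if p ≤ i ∧ i < p + M then c else 0

theorem supportedOn_window (p M : ℕ) (c : Q) : SupportedOn (window p M c) p (p + M) :=
  fun i hi => if_neg (by omega)

theorem window_mem {F : ℕ → Finset Q} (h0 : ∀ i, 0 ∈ F i) (hmono : Monotone F) {p : ℕ} {c : Q}
    (hc : c ∈ F p) (M i : ℕ) : window p M c i ∈ F i := by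
  unfold window
  split_ifs with h
  · exact hmono h.1 hc
  · exact h0 i

theorem sum_window (p M : ℕ) (c : Q) (n : ℕ) :
    ∑ i ∈ Finset.range n, window p M c i = min (n - p) M • c := by
  induction n with
  | zero => simp
  | succ n ih =>
    rw [Finset.sum_range_succ, ih, window]
    split_ifs with h
    · rw [← succ_nsmul]
      congr 1
      omega
    · rw [add_zero]
      congr 1
      omega

theorem sum_range_apply_window {ψ : ℕ → Q → Y} (hψ : ∀ i, ψ i 0 = 0) (p M : ℕ) (c : Q) :
    ∑ i ∈ Finset.range (p + M), ψ i (window p M c i) = ∑ i ∈ Finset.Ico p (p + M), ψ i c := by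
  rw [← Finset.sum_range_add_sum_Ico _ (Nat.le_add_right p M), Finset.sum_eq_zero, zero_add]
  · refine Finset.sum_congr rfl fun i hi => ?_
    rw [window, if_pos (Finset.mem_Ico.1 hi)]
  · intro i hi
    rw [supportedOn_window p M c i (Or.inl (Finset.mem_range.1 hi)), hψ]

theorem Balanced.nsmul_mem [Module ℝ X] {W : Set X} (hW : Balanced ℝ W) {M l : ℕ} {v : X}
    (h : M • v ∈ W) (hl : l ≤ M) : l • v ∈ W := by
  rcases Nat.eq_zero_or_pos M with rfl | hM
  · obtain rfl : l = 0 := by omega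
    exact h
  · have hM' : (0 : ℝ) < M := by exact_mod_cast hM
    have hle : ‖((l : ℝ) / M)‖ ≤ 1 := by
      rw [Real.norm_of_nonneg (by positivity), div_le_one hM']
      exact_mod_cast hl
    have := hW.smul_mem hle h
    rwa [← Nat.cast_smul_eq_nsmul ℝ M v, smul_smul, div_mul_cancel₀ _ hM'.ne',
      Nat.cast_smul_eq_nsmul] at this

/-- Balancedness is enough: the intermediate points `l • ι c` with `l ≤ M` are scalings of the end
point `M • ι c`. -/
theorem isPath_window [Module ℝ X] {ι : Q →+ X} {F : ℕ → Finset Q} {W : Set X}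
    (h0 : ∀ i, 0 ∈ F i) (hmono : Monotone F) (hW : Balanced ℝ W) {p M : ℕ} {c : Q} (hc : c ∈ F p)
    (hcW : ι (M • c) ∈ W) : IsPath ι F W p (p + M) (window p M c) := by
  refine ⟨window_mem h0 hmono hc M, supportedOn_window p M c, Nat.le_add_right p M, fun n => ?_⟩
  rw [← map_sum, sum_window, map_nsmul]
  rw [map_nsmul] at hcW
  exact hW.nsmul_mem hcW (min_le_right _ _)

theorem sum_Ico_mul (f : ℕ → Y) (p M N : ℕ) :
    ∑ i ∈ Finset.Ico p (p + N * M), f i =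
      ∑ r ∈ Finset.range N, ∑ i ∈ Finset.Ico (p + r * M) (p + r * M + M), f i := by
  induction N with
  | zero => simp
  | succ N ih =>
    rw [Finset.sum_range_succ, ← ih, Finset.sum_Ico_consecutive _ (by omega) (by omega)]
    congr 2
    ring

theorem AddGroupSeminorm.sum_le (p : AddGroupSeminorm Y) {α : Type*} (s : Finset α) (f : α → Y) :
    p (∑ i ∈ s, f i) ≤ ∑ i ∈ s, p (f i) :=
  Finset.le_sum_of_subadditive p (map_zero p).le (map_add_le_add p) s f

theorem AddGroupSeminorm.nsmul_le (p : AddGroupSeminorm Y) (n : ℕ) (y : Y) :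
    p (n • y) ≤ n * p y := by
  simpa using p.sum_le (Finset.range n) fun _ => y

end Window

section Limit

theorem IsSeriesReduction.eventually_mem {X Y Q : Type*} [AddCommGroup X] [TopologicalSpace X]
    [AddCommGroup Y] [TopologicalSpace Y] [AddCommGroup Q] {ι : Q →+ X} {F : ℕ → Finset Q}
    {φ : ℕ → Q → Y} (h : IsSeriesReduction ι F φ) (g : Q) :
    ∀ᶠ j in atTop, g ∈ F j := by
  obtain ⟨i, hi⟩ := h.exists_mem g
  filter_upwards [eventually_ge_atTop i] with j hj
  exact h.mono hj hi

variable {X Y Q : Type*} [AddCommGroup X] [Module ℝ X] [TopologicalSpace X]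
  [AddCommGroup Y] [TopologicalSpace Y]
  [AddCommGroup Q] [Module ℚ Q] {ι : Q →+ X} {F : ℕ → Finset Q} {φ : ℕ → Q → Y}

theorem nsmul_inv_smul (N : ℕ) (hN : 0 < N) (g : Q) : N • ((N : ℚ)⁻¹ • g) = g := by
  rw [← Nat.cast_smul_eq_nsmul ℚ, smul_smul, mul_inv_cancel₀ (by exact_mod_cast hN.ne'), one_smul]

theorem eventually_inv_smul_mem [ContinuousSMul ℝ X] (ι : Q →+ X) {W : Set X} (hW : W ∈ 𝓝 0) (g : Q) :
    ∀ᶠ N : ℕ in atTop, ι ((N : ℚ)⁻¹ • g) ∈ W := by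
  have h1 : Tendsto (fun N : ℕ => ((N : ℝ)⁻¹) • ι g) atTop (𝓝 0) := by
    simpa using (tendsto_inv_atTop_nhds_zero_nat (𝕜 := ℝ)).smul_const (ι g)
  filter_upwards [h1.eventually hW, eventually_gt_atTop 0] with N hN hN0
  have h3 : (N : ℝ)⁻¹ • ι g ∈ W := hN
  have h2 := congrArg ι (nsmul_inv_smul N hN0 g)
  rw [map_nsmul, ← Nat.cast_smul_eq_nsmul ℝ] at h2
  rwa [← h2, smul_smul, inv_mul_cancel₀ (by exact_mod_cast hN0.ne'), one_smul] at h3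

/-- Subdividing a window into `N` windows, each of which can be compared with a late step. -/
theorem IsPathNhds.window_small (h : IsSeriesReduction ι F φ) {p : AddGroupSeminorm Y}
    {W : Set X} (hW : IsPathNhds ι F φ p W) {g : Q} {N : ℕ} (hN : 0 < N)
    (hgW : ι ((N : ℚ)⁻¹ • g) ∈ W) {ε : ℝ} (hε : 0 < ε) :
    ∃ K, ∀ a ≥ K, ∀ M c, c ∈ F a → (N * M) • c = g → ∃ J, ∀ j ≥ J,
      p (∑ i ∈ Finset.Ico a (a + N * M), φ i c + N • φ j (-((N : ℚ)⁻¹ • g))) < ε := by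
  have hN' : (0 : ℝ) < N := by exact_mod_cast hN
  -- Each of the `N` subwindows costs at most `ε / (2 * N)`, in total `ε / 2`.
  obtain ⟨K, hK⟩ := hW.small (ε / (2 * N)) (by positivity)
  refine ⟨K, fun a ha M c hc hcg => ?_⟩
  obtain ⟨J, hJ⟩ := eventually_atTop.1 (h.eventually_mem (-((N : ℚ)⁻¹ • g)))
  refine ⟨max J (a + N * M), fun j hj => ?_⟩
  have hMc : M • c = (N : ℚ)⁻¹ • g := by
    rw [← hcg, mul_nsmul', ← Nat.cast_smul_eq_nsmul ℚ N, smul_smul,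
      inv_mul_cancel₀ (by exact_mod_cast hN.ne'), one_smul]
  have hstep : ∀ r < N, p (∑ i ∈ Finset.Ico (a + r * M) (a + r * M + M), φ i c +
      φ j (-((N : ℚ)⁻¹ • g))) ≤ ε / (2 * N) := by
    intro r hr
    have hpath : IsPath ι F W (a + r * M) (a + r * M + M) (window (a + r * M) M c) :=
      isPath_window h.zero_mem h.mono hW.balanced (h.mono (by omega) hc) (by rwa [hMc])
    have hT : ∑ i ∈ Finset.range (a + r * M + M), window (a + r * M) M c i = (N : ℚ)⁻¹ • g := by
      rw [sum_window, ← hMc]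
      congr 1
      omega
    have hle : a + r * M + M ≤ a + N * M := by
      have : (r + 1) * M ≤ N * M := Nat.mul_le_mul_right M hr
      rw [add_mul, one_mul] at this
      omega
    have := hK _ (by omega) _ _ hpath j (by omega) (by rw [hT]; exact hJ j (by omega))
    rw [hT, sum_range_apply_window h.apply_zero] at this
    exact this.le
  rw [sum_Ico_mul]
  have e : ∑ r ∈ Finset.range N, ∑ i ∈ Finset.Ico (a + r * M) (a + r * M + M), φ i c +
      N • φ j (-((N : ℚ)⁻¹ • g)) = ∑ r ∈ Finset.range N,
        (∑ i ∈ Finset.Ico (a + r * M) (a + r * M + M), φ i c + φ j (-((N : ℚ)⁻¹ • g))) := by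
    rw [Finset.sum_add_distrib, Finset.sum_const, Finset.card_range]
  rw [e]
  refine (p.sum_le _ _).trans_lt ?_
  refine (Finset.sum_le_card_nsmul _ _ _ fun r hr => hstep r (Finset.mem_range.1 hr)).trans_lt ?_
  rw [Finset.card_range, nsmul_eq_mul]
  have : (N : ℝ) * (ε / (2 * N)) = ε / 2 := by field_simp
  linarith

variable [ContinuousSMul ℝ X] {q : ℕ → AddGroupSeminorm Y}

/-- The limit map of a series reduction. -/
theorem IsSeriesReduction.exists_limit [IsTopologicalAddGroup Y] (h : IsSeriesReduction ι F φ)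
    (hq : IsCompleteGauge q)
    {W : ℕ → Set X} (hW : ∀ n, IsPathNhds ι F φ (q n) (W n)) (g : Q) :
    ∃ s : Y, ∀ n N : ℕ, 0 < N → ι ((N : ℚ)⁻¹ • g) ∈ W n → ∀ ε > 0, ∀ᶠ j in atTop,
      q n (s + N • φ j (-((N : ℚ)⁻¹ • g))) < ε := by
  -- Steps of size `g / k!` are used because every `N ≤ k` divides `k!`, so the same walks can be
  -- cut into `N` equal parts for each `N`.
  have hpos : ∀ k : ℕ, ∃ a, k ≤ a ∧ ((k.factorial : ℚ)⁻¹ • g) ∈ F a := fun k =>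
    ((eventually_ge_atTop k).and (h.eventually_mem _)).exists
  choose a hka haF using hpos
  set y : ℕ → Y := fun k => ∑ i ∈ Finset.Ico (a k) (a k + k.factorial),
    φ i ((k.factorial : ℚ)⁻¹ • g) with hy
  have hest : ∀ n N : ℕ, 0 < N → ι ((N : ℚ)⁻¹ • g) ∈ W n → ∀ ε > 0, ∀ᶠ k in atTop,
      ∀ᶠ j in atTop, q n (y k + N • φ j (-((N : ℚ)⁻¹ • g))) < ε := by
    intro n N hN hgW ε hε
    obtain ⟨K, hK⟩ := (hW n).window_small h hN hgW hε
    filter_upwards [eventually_ge_atTop K, eventually_ge_atTop N] with k hkK hkN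
    obtain ⟨M, hM⟩ := Nat.dvd_factorial hN hkN
    obtain ⟨J, hJ⟩ := hK (a k) (hkK.trans (hka k)) M _ (haF k) (by
      rw [← hM]; exact nsmul_inv_smul _ k.factorial_pos g)
    filter_upwards [eventually_ge_atTop J] with j hj
    have := hJ j hj
    rwa [← hM] at this
  obtain ⟨s, hs⟩ := hq.complete y fun n ε hε => by
    obtain ⟨N, hgW, hN⟩ := ((eventually_inv_smul_mem ι (hW n).mem_nhds g).and
      (eventually_gt_atTop 0)).exists
    obtain ⟨K, hK⟩ := eventually_atTop.1 (hest n N hN hgW (ε / 2) (half_pos hε))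
    refine ⟨K, fun i hi j hj => ?_⟩
    obtain ⟨l, h1, h2⟩ := ((hK i hi).and (hK j hj)).exists
    have := map_sub_le_add (q n) (y i + N • φ l (-((N : ℚ)⁻¹ • g)))
      (y j + N • φ l (-((N : ℚ)⁻¹ • g)))
    rw [add_sub_add_right_eq_sub] at this
    linarith
  refine ⟨s, fun n N hN hgW ε hε => ?_⟩
  have h1 : ∀ᶠ k in atTop, q n (s - y k) < ε / 2 := by
    have : Tendsto (fun k => s - y k) atTop (𝓝 0) := by simpa using hs.const_sub s
    exact this.eventually (hq.setOf_lt_mem n (half_pos hε))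
  obtain ⟨k, hk, hk'⟩ := (h1.and (hest n N hN hgW (ε / 2) (half_pos hε))).exists
  filter_upwards [hk'] with j hj
  have := map_add_le_add (q n) (s - y k) (y k + N • φ j (-((N : ℚ)⁻¹ • g)))
  rw [← add_assoc, sub_add_cancel] at this
  linarith

omit [ContinuousSMul ℝ X] in
theorem IsCompleteGauge.eq_zero [T1Space Y] (hq : IsCompleteGauge q) {y : Y}
    (h : ∀ n, ∀ ε > 0, q n y < ε) : y = 0 := by
  by_contra hy
  have hU : {y}ᶜ ∈ 𝓝 (0 : Y) := isOpen_compl_singleton.mem_nhds (Ne.symm hy)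
  obtain ⟨n, ε, hε, hU⟩ := (hq.mem_nhds_zero_iff _).1 hU
  exact hU y (h n ε hε) rfl

/-- The limit map is additive and it approximates `φ` on late small steps. -/
theorem IsSeriesReduction.exists_addMonoidHom [IsTopologicalAddGroup Y] [T1Space Y]
    (h : IsSeriesReduction ι F φ) (hq : IsCompleteGauge q)
    {W : ℕ → Set X} (hW : ∀ n, IsPathNhds ι F φ (q n) (W n)) :
    ∃ S : Q →+ Y, ∀ n, ∀ ε > 0, ∃ K, ∀ g, ι g ∈ W n → ∀ j ≥ K, g ∈ F j →
      q n (φ j g - S g) < ε := by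
  choose S hS using h.exists_limit hq hW
  -- The steps `-g/N`, `-k/N` at `j`, `j + 1`, closed by `(g + k)/N` at `j + 2`, form a loop; `N`
  -- times its image approximates minus the left side.
  have htri : ∀ g k, S g + S k + S (-(g + k)) = 0 := by
    intro g k
    refine hq.eq_zero fun n ε hε => ?_
    obtain ⟨N, hgW, hkW, hgkW, hN⟩ := ((eventually_inv_smul_mem ι (hW n).mem_nhds g).and
      ((eventually_inv_smul_mem ι (hW n).mem_nhds k).and
      ((eventually_inv_smul_mem ι (hW n).mem_nhds (-(g + k))).and
      (eventually_gt_atTop 0)))).exists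
    have hN' : (0 : ℝ) < N := by exact_mod_cast hN
    obtain ⟨K, hK⟩ := (hW n).small (ε / (4 * N)) (by positivity)
    set c := (N : ℚ)⁻¹ • g with hc
    set d := (N : ℚ)⁻¹ • k with hd
    have hcd : (N : ℚ)⁻¹ • (-(g + k)) = -c + -d := by
      rw [smul_neg, smul_add, neg_add]
    rw [hcd] at hgkW
    have hs1 := hS g n N hN hgW (ε / 4) (by positivity)
    have hs2 := (tendsto_add_atTop_nat 1).eventually (hS k n N hN hkW (ε / 4) (by positivity))
    have hs3 := (tendsto_add_atTop_nat 2).eventually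
      (hS (-(g + k)) n N hN (by rwa [hcd]) (ε / 4) (by positivity))
    rw [hcd] at hs3
    obtain ⟨j, h1, h2, h3, hjc, hjd, hjcd, hjK⟩ := (hs1.and (hs2.and (hs3.and
      ((h.eventually_mem (-c)).and ((h.eventually_mem (-d)).and
        ((h.eventually_mem (-(-c + -d))).and (eventually_ge_atTop K))))))).exists
    have hW0 : (0 : X) ∈ W n := mem_of_mem_nhds (hW n).mem_nhds
    have hp1 : IsPath ι F (W n) j (j + 1) (Pi.single j (-c)) :=
      isPath_single h.zero_mem hW0 hjc (by rw [map_neg]; exact (hW n).balanced.neg_mem_iff.2 hgW)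
    have hsum1 : ∑ i ∈ Finset.range (j + 1), (Pi.single j (-c) : ℕ → Q) i = -c := by
      simp
    have hp2 := hp1.update (e := j + 1) le_rfl (h.mono (Nat.le_succ j) hjd)
      (by rwa [hsum1])
    have hsum2 : ∑ i ∈ Finset.range (j + 1 + 1),
        Function.update (Pi.single j (-c) : ℕ → Q) (j + 1) (-d) i = -c + -d := by
      rw [hp1.supp.sum_update (ψ := fun _ x => x) (fun _ => rfl) le_rfl, hsum1]
    have hφ1 : ∑ i ∈ Finset.range (j + 1), φ i ((Pi.single j (-c) : ℕ → Q) i) = φ j (-c) := by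
      rw [Finset.sum_eq_single j]
      · simp
      · intro i _ hij
        rw [Pi.single_eq_of_ne hij, h.apply_zero]
      · intro hj
        exact absurd (Finset.self_mem_range_succ j) hj
    have hφ2 : ∑ i ∈ Finset.range (j + 1 + 1),
        φ i (Function.update (Pi.single j (-c) : ℕ → Q) (j + 1) (-d) i) =
          φ j (-c) + φ (j + 1) (-d) := by
      rw [hp1.supp.sum_update h.apply_zero le_rfl, hφ1]
    have h4 := hK j hjK _ _ hp2 (j + 2) le_rfl
      (by rw [hsum2]; exact h.mono (Nat.le_add_right j 2) hjcd)
    rw [hsum2, hφ2] at h4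
    have key : S g + S k + S (-(g + k)) = ((S g + N • φ j (-c)) + (S k + N • φ (j + 1) (-d))) +
        ((S (-(g + k)) + N • φ (j + 2) (-(-c + -d))) -
          N • (φ j (-c) + φ (j + 1) (-d) + φ (j + 2) (-(-c + -d)))) := by
      rw [nsmul_add, nsmul_add]; abel
    have b1 := map_add_le_add (q n) ((S g + N • φ j (-c)) + (S k + N • φ (j + 1) (-d)))
      ((S (-(g + k)) + N • φ (j + 2) (-(-c + -d))) -
          N • (φ j (-c) + φ (j + 1) (-d) + φ (j + 2) (-(-c + -d))))
    have b2 := map_add_le_add (q n) (S g + N • φ j (-c)) (S k + N • φ (j + 1) (-d))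
    have b3 := map_sub_le_add (q n) (S (-(g + k)) + N • φ (j + 2) (-(-c + -d)))
          (N • (φ j (-c) + φ (j + 1) (-d) + φ (j + 2) (-(-c + -d))))
    have b4 := (q n).nsmul_le N (φ j (-c) + φ (j + 1) (-d) + φ (j + 2) (-(-c + -d)))
    have b5 : (N : ℝ) * q n (φ j (-c) + φ (j + 1) (-d) + φ (j + 2) (-(-c + -d))) < ε / 4 := by
      have : (N : ℝ) * (ε / (4 * N)) = ε / 4 := by field_simp
      rw [← this]
      exact mul_lt_mul_of_pos_left h4 hN'
    rw [key]
    linarith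
  have hS0 : S 0 = 0 := by
    refine hq.eq_zero fun n ε hε => ?_
    have := hS 0 n 1 one_pos (by simpa using mem_of_mem_nhds (hW n).mem_nhds) ε hε
    obtain ⟨j, hj⟩ := this.exists
    simpa [h.apply_zero] using hj
  have hSneg : ∀ g, S (-g) = -S g := by
    intro g
    have := htri g 0
    rw [hS0, add_zero, add_zero] at this
    exact eq_neg_of_add_eq_zero_right this
  refine ⟨⟨⟨S, hS0⟩, fun g k => ?_⟩, fun n ε hε => ?_⟩
  · have := htri g k
    rw [hSneg] at this
    exact (add_neg_eq_zero.1 this).symm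
  -- With `N = 1`, both `φ j g` and `S g` are close to `-φ k (-g)` for late `k`.
  · obtain ⟨K, hK⟩ := (hW n).small (ε / 2) (half_pos hε)
    refine ⟨K, fun g hg j hj hgF => ?_⟩
    have hW0 : (0 : X) ∈ W n := mem_of_mem_nhds (hW n).mem_nhds
    have hp := isPath_single h.zero_mem hW0 hgF hg
    obtain ⟨k, h1, h2, h3⟩ := ((hS g n 1 one_pos (by simpa using hg) (ε / 2) (half_pos hε)).and
      ((h.eventually_mem (-g)).and (eventually_ge_atTop (j + 1)))).exists
    have hsum : ∑ i ∈ Finset.range (j + 1), (Pi.single j g : ℕ → Q) i = g := by simp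
    have hφ : ∑ i ∈ Finset.range (j + 1), φ i ((Pi.single j g : ℕ → Q) i) = φ j g := by
      rw [Finset.sum_eq_single j]
      · simp
      · intro i _ hij
        rw [Pi.single_eq_of_ne hij, h.apply_zero]
      · intro hj
        exact absurd (Finset.self_mem_range_succ j) hj
    have h4 := hK j hj _ _ hp k h3 (by rwa [hsum])
    rw [hsum, hφ] at h4
    have h5 : q n (S g + φ k (-g)) < ε / 2 := by simpa using h1
    have := map_sub_le_add (q n) (φ j g + φ k (-g)) (S g + φ k (-g))
    rw [add_sub_add_right_eq_sub] at this
    change q n (φ j g - S g) < ε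
    linarith

end Limit

/-! ### Comparison of the topologies induced by `ι` and `S` -/

section Embedding

/-- If `S g` is small then going to `g` and back in small steps is a block whose image under `φ`
is small. -/
theorem IsSeriesReduction.exists_block {X Y Q : Type*} [AddCommGroup X] [Module ℝ X]
    [TopologicalSpace X] [ContinuousSMul ℝ X] [AddCommGroup Y] [TopologicalSpace Y]
    [AddCommGroup Q] [Module ℚ Q] {ι : Q →+ X} {F : ℕ → Finset Q} {φ : ℕ → Q → Y} {S : Q →+ Y}
    (h : IsSeriesReduction ι F φ)
    {p : AddGroupSeminorm Y} {V V' : Set X} (hV : V ∈ 𝓝 0) (hV' : V' ∈ 𝓝 0)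
    (hVb : Balanced ℝ V')
    (hS : ∀ ε > 0, ∃ K, ∀ g, ι g ∈ V → ∀ j ≥ K, g ∈ F j → p (φ j g - S g) < ε)
    (hVneg : Balanced ℝ V) {ε : ℝ} (hε : 0 < ε) {g : Q}
    (hg : ∀ N l : ℕ, l ≤ N → ∀ z, N • z = S g → p (l • z) < ε) (k : ℕ) :
    ∃ x n b, k ≤ n ∧ n ≤ b ∧ k < b ∧ (∀ i, x i ∈ F i) ∧ SupportedOn x k b ∧ (∀ i, ι (x i) ∈ V') ∧
      ∑ i ∈ Finset.range n, ι (x i) = ι g ∧ p (∑ i ∈ Finset.range b, φ i (x i)) ≤ ε ∧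
      ∀ m, p (∑ i ∈ Finset.range m, φ i (x i)) ≤ 2 * ε := by
  obtain ⟨N, hNV, hNV', hN⟩ := ((eventually_inv_smul_mem ι hV g).and
    ((eventually_inv_smul_mem ι hV' g).and (eventually_gt_atTop 0))).exists
  have hN' : (0 : ℝ) < N := by exact_mod_cast hN
  set c := (N : ℚ)⁻¹ • g with hc
  have hcg : N • c = g := nsmul_inv_smul N hN g
  -- The walk has `2 * N` nonzero steps at most, `N` of `c` and `N` of `-c`, so replacing `φ` by `S`
  -- costs `ε` in total.
  obtain ⟨K, hK⟩ := hS (ε / (2 * N)) (by positivity)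
  obtain ⟨a, hka, hKa, hca⟩ := ((eventually_ge_atTop k).and ((eventually_ge_atTop K).and
    (h.eventually_mem c))).exists
  set x : ℕ → Q := fun i => window a N c i + window (a + N) N (-c) i with hx
  have hxval : ∀ i, x i = 0 ∨ (a ≤ i ∧ i < a + 2 * N ∧ (x i = c ∨ x i = -c)) := by
    intro i
    simp only [hx, window]
    split_ifs with h1 h2 h2
    · omega
    · exact Or.inr ⟨by omega, by omega, by simp⟩
    · exact Or.inr ⟨by omega, by omega, by simp⟩
    · simp
  have hιx : ∀ i, ι (x i) ∈ V ∧ ι (x i) ∈ V' := by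
    intro i
    rcases hxval i with h0 | ⟨-, -, h0 | h0⟩
    · rw [h0, map_zero]; exact ⟨mem_of_mem_nhds hV, mem_of_mem_nhds hV'⟩
    · rw [h0]; exact ⟨hNV, hNV'⟩
    · rw [h0, map_neg]; exact ⟨hVneg.neg_mem_iff.2 hNV, hVb.neg_mem_iff.2 hNV'⟩
  have hxF : ∀ i, x i ∈ F i := by
    intro i
    rcases hxval i with h0 | ⟨hi, -, h0 | h0⟩
    · rw [h0]; exact h.zero_mem i
    · rw [h0]; exact h.mono hi hca
    · rw [h0]; exact h.neg_mem _ _ (h.mono hi hca)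
  have hsupp : SupportedOn x k (a + 2 * N) := by
    intro i hi
    rcases hxval i with h0 | ⟨h1, h2, -⟩
    · exact h0
    · omega
  have hsum : ∀ m, ∑ i ∈ Finset.range m, x i =
      min (m - a) N • c - min (m - (a + N)) N • c := by
    intro m
    rw [hx, Finset.sum_add_distrib, sum_window, sum_window, smul_neg, sub_eq_add_neg]
  have hsumS : ∀ m, p (S (∑ i ∈ Finset.range m, x i)) < ε := by
    intro m
    have hle : min (m - (a + N)) N ≤ min (m - a) N := by omega
    rw [hsum, sub_eq_add_neg, ← sub_nsmul c hle, map_nsmul]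
    refine hg N _ ?_ _ ?_
    · exact (Nat.sub_le _ _).trans (min_le_right _ _)
    · rw [← map_nsmul, hcg]
  have herr : ∀ m, p (∑ i ∈ Finset.range m, φ i (x i) - S (∑ i ∈ Finset.range m, x i)) ≤ ε := by
    intro m
    rw [map_sum, ← Finset.sum_sub_distrib]
    refine (p.sum_le _ _).trans ?_
    have hterm : ∀ i, p (φ i (x i) - S (x i)) ≤
        if i ∈ Finset.Ico a (a + 2 * N) then ε / (2 * N) else 0 := by
      intro i
      split_ifs with hi
      · exact (hK _ (hιx i).1 i (hKa.trans (Finset.mem_Ico.1 hi).1) (hxF i)).le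
      · rcases hxval i with h0 | ⟨h1, h2, -⟩
        · simp [h0, h.apply_zero]
        · exact absurd (Finset.mem_Ico.2 ⟨h1, h2⟩) hi
    refine (Finset.sum_le_sum fun i _ => hterm i).trans ?_
    rw [Finset.sum_ite_mem, Finset.sum_const, nsmul_eq_mul]
    have hcard : ((Finset.range m ∩ Finset.Ico a (a + 2 * N)).card : ℝ) ≤ 2 * N := by
      have : (Finset.range m ∩ Finset.Ico a (a + 2 * N)).card ≤ 2 * N := by
        refine (Finset.card_le_card Finset.inter_subset_right).trans ?_
        simp
      exact_mod_cast this
    calc _ ≤ (2 * N : ℝ) * (ε / (2 * N)) := by gcongr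
      _ = ε := by field_simp
  refine ⟨x, a + N, a + 2 * N, by omega, by omega, by omega, hxF, hsupp, fun i => (hιx i).2,
    ?_, ?_, fun m => ?_⟩
  · rw [← map_sum, hsum]
    simp [hcg]
  · have h1 := herr (a + 2 * N)
    have h2 : ∑ i ∈ Finset.range (a + 2 * N), x i = 0 := by
      rw [hsum, sub_eq_zero]
      congr 1
      omega
    rwa [h2, map_zero, sub_zero] at h1
  · have h1 := map_add_le_add p
      (∑ i ∈ Finset.range m, φ i (x i) - S (∑ i ∈ Finset.range m, x i))
      (S (∑ i ∈ Finset.range m, x i))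
    rw [sub_add_cancel] at h1
    linarith [herr m, hsumS m]

variable {X Y Q : Type*} [AddCommGroup X] [Module ℝ X] [TopologicalSpace X]
  [IsTopologicalAddGroup X] [ContinuousSMul ℝ X] [FirstCountableTopology X]
  [AddCommGroup Y] [Module ℝ Y] [TopologicalSpace Y] [IsTopologicalAddGroup Y]
  [ContinuousSMul ℝ Y]
  [AddCommGroup Q] [Module ℚ Q] {ι : Q →+ X} {F : ℕ → Finset Q} {φ : ℕ → Q → Y}
  {q : ℕ → AddGroupSeminorm Y} {W : ℕ → Set X} {S : Q →+ Y}

-- `S g` is close to `φ j g` for late `j`, and the latter is small because a single step is a path.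
omit [Module ℝ X] [ContinuousSMul ℝ X] [Module ℝ Y] [ContinuousSMul ℝ Y] [Module ℚ Q] in
theorem IsSeriesReduction.comap_le_comap (h : IsSeriesReduction ι F φ) (hq : IsCompleteGauge q)
    (hW : ∀ n, W n ∈ 𝓝 0)
    (hS : ∀ n, ∀ ε > 0, ∃ K, ∀ g, ι g ∈ W n → ∀ j ≥ K, g ∈ F j → q n (φ j g - S g) < ε) :
    comap ι (𝓝 0) ≤ comap S (𝓝 0) := by
  rw [← map_le_iff_le_comap]
  intro U hU
  obtain ⟨n, ε, hε, hU⟩ := (hq.mem_nhds_zero_iff U).1 hU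
  obtain ⟨O, hO, K, hK⟩ := h.exists_nhds_path (hq.setOf_lt_mem n (half_pos hε))
  obtain ⟨K', hK'⟩ := hS n (ε / 2) (half_pos hε)
  refine ⟨W n ∩ O, inter_mem (hW n) hO, fun g hg => hU _ ?_⟩
  obtain ⟨j, h1, h2, h3⟩ := ((h.eventually_mem g).and ((eventually_ge_atTop K).and
    (eventually_ge_atTop K'))).exists
  have h4 := hK j h2 _ _ (isPath_single h.zero_mem (mem_of_mem_nhds hO) h1 hg.2)
  have hφ : ∑ i ∈ Finset.range (j + 1), φ i ((Pi.single j g : ℕ → Q) i) = φ j g := by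
    rw [Finset.sum_eq_single j]
    · simp
    · intro i _ hij
      rw [Pi.single_eq_of_ne hij, h.apply_zero]
    · intro hj
      exact absurd (Finset.self_mem_range_succ j) hj
  rw [hφ] at h4
  have h4' : q n (φ j g) < ε / 2 := h4
  have h5 := hK' g hg.1 j h3 h1
  have := map_sub_le_add (q n) (φ j g) (φ j g - S g)
  rw [sub_sub_cancel] at this
  linarith

omit [IsTopologicalAddGroup Y] in
theorem IsCompleteGauge.exists_smul_lt (hq : IsCompleteGauge q) (n : ℕ) {ε : ℝ} (hε : 0 < ε) :
    ∃ U ∈ 𝓝 (0 : Y), ∀ y ∈ U, ∀ N l : ℕ, l ≤ N → ∀ z, N • z = y → q n (l • z) < ε := by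
  obtain ⟨U, ⟨hU, hUb⟩, hUε⟩ := (nhds_basis_balanced ℝ Y).mem_iff.1 (hq.setOf_lt_mem n hε)
  exact ⟨U, hU, fun y hy N l hl z hz => hUε (hUb.nsmul_mem (by rwa [hz]) hl)⟩

/-- Otherwise glue walks to `g` and back, with `S g` ever smaller and `ι g ∉ O`. The `φ`-series
converges and the `ι`-terms tend to zero, so the `ι`-series converges, although its partial sums
keep making excursions outside `O`. -/
theorem IsSeriesReduction.comap_ge_comap (h : IsSeriesReduction ι F φ) (hq : IsCompleteGauge q)
    (hW : ∀ n, W n ∈ 𝓝 0) (hWb : ∀ n, Balanced ℝ (W n))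
    (hS : ∀ n, ∀ ε > 0, ∃ K, ∀ g, ι g ∈ W n → ∀ j ≥ K, g ∈ F j → q n (φ j g - S g) < ε) :
    comap S (𝓝 0) ≤ comap ι (𝓝 0) := by
  rw [← map_le_iff_le_comap]
  intro O hO
  by_contra hcon
  have hbad : ∀ U ∈ 𝓝 (0 : Y), ∃ g, S g ∈ U ∧ ι g ∉ O := by
    intro U hU
    by_contra! hU'
    exact hcon ⟨U, hU, fun g hg => hU' g hg⟩
  obtain ⟨B, hB⟩ := (𝓝 (0 : X)).exists_antitone_basis
  obtain ⟨a, x, ha, -, hax⟩ := exists_blocks (P := fun r k x b => ∃ n, k ≤ n ∧ n ≤ b ∧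
      (∀ i, x i ∈ F i) ∧ SupportedOn x k b ∧ (∀ i, ι (x i) ∈ B r) ∧
      ∑ i ∈ Finset.range n, ι (x i) ∉ O ∧
      q r (∑ i ∈ Finset.range b, φ i (x i)) ≤ (1 / 2) ^ r ∧
      ∀ m, q r (∑ i ∈ Finset.range m, φ i (x i)) ≤ 2 * (1 / 2) ^ r) (by
    intro r k
    obtain ⟨U, hU, hUε⟩ := hq.exists_smul_lt r (ε := (1 / 2) ^ r) (by positivity)
    obtain ⟨g, hgU, hgO⟩ := hbad U hU
    obtain ⟨V', ⟨hV', hVb'⟩, hVB⟩ := (nhds_basis_balanced ℝ X).mem_iff.1 (hB.mem r)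
    obtain ⟨x, n, b, h1, h2, h3, h4, h5, h6, h7, h8, h9⟩ :=
      h.exists_block (hW r) hV' hVb' (hS r) (hWb r) (ε := (1 / 2) ^ r) (by positivity)
        (hUε _ hgU) k
    exact ⟨x, b, h3, n, h1, h2, h4, h5, fun i => hVB (h6 i), by rwa [h7], h8, h9⟩) 0
  choose n han hnb hF hsupp hι hO' htot hpart using hax
  have hXF := concat_mem ha hsupp h.zero_mem hF
  have hι0 : Tendsto (fun i => ι (concat x i)) atTop (𝓝 0) := by
    intro V hV
    obtain ⟨R, hR⟩ := hB.mem_iff.1 hV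
    change ∀ᶠ i in atTop, ι (concat x i) ∈ V
    filter_upwards [eventually_ge_atTop (a R)] with i hi
    obtain ⟨r, hr, hr'⟩ := ha.exists_le_lt_succ ((ha.monotone (Nat.zero_le R)).trans hi)
    rw [concat_eq ha hsupp hr hr']
    exact hR (hB.antitone (Nat.lt_succ_iff.1 (ha.lt_iff_lt.1 (hi.trans_lt hr'))) (hι r i))
  obtain ⟨l, hl⟩ := hq.exists_tendsto_sum (C := 1)
    (e := fun r => ∑ i ∈ Finset.range (a (r + 1)), φ i (x r i)) (by simpa using htot)
  have hφ : Tendsto (fun n => ∑ i ∈ Finset.range n, φ i (concat x i)) atTop (𝓝 l) := by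
    refine tendsto_sum_concat ha hsupp h.apply_zero hl fun U hU => ?_
    obtain ⟨m, ε, hε, hU⟩ := (hq.mem_nhds_zero_iff U).1 hU
    have hsmall : ∀ᶠ j : ℕ in atTop, 2 * (1 / 2 : ℝ) ^ j < ε := by
      have : Tendsto (fun j : ℕ => 2 * (1 / 2 : ℝ) ^ j) atTop (𝓝 0) := by
        simpa using (tendsto_pow_atTop_nhds_zero_of_lt_one (r := (1 / 2 : ℝ))
          (by norm_num) (by norm_num)).const_mul 2
      exact this.eventually_lt_const hε
    filter_upwards [hsmall, eventually_ge_atTop m] with r h1 h2 k _ _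
    exact hU _ (((hq.mono h2 _).trans (hpart r k)).trans_lt h1)
  obtain ⟨l', hl'⟩ := h.convergent_of _ hXF hι0 ⟨l, hφ⟩
  obtain ⟨r, hr⟩ := (eventually_block_sum_mem (ψ := fun _ => ι) ha hsupp (fun _ => map_zero ι)
    hl' hO).exists
  exact hO' r (hr (n r) (han r) (hnb r))

end Embedding

/-- A reduction of `E(X)` to `E(Y)` gives a closed linear embedding of `X` into `Y`, provided that
the topology of `Y` is given by seminorms with the finite sums property. -/
theorem exists_closed_submodule_of_borelReducible {X Y : Type*}
    [AddCommGroup X] [Module ℝ X] [TopologicalSpace X] [IsTopologicalAddGroup X]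
    [ContinuousSMul ℝ X] [PolishSpace X]
    [AddCommGroup Y] [Module ℝ Y] [TopologicalSpace Y] [IsTopologicalAddGroup Y]
    [ContinuousSMul ℝ Y] [PolishSpace Y] {q : ℕ → AddGroupSeminorm Y} (hq : IsCompleteGauge q)
    (hfs : ∀ n, HasFiniteSumsProperty (q n))
    (hred : BorelReducible (inducedRel (Multiplicative X)) (inducedRel (Multiplicative Y))) :
    ∃ Z : Submodule ℝ Y, IsClosed (Z : Set Y) ∧ Nonempty (X ≃L[ℝ] Z) := by
  -- `ℕ →₀ ℚ` maps onto the rational span of a dense sequence: countable for the coding, divisible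
  -- for the equal subdivisions.
  let u := TopologicalSpace.denseSeq X
  let ι : (ℕ →₀ ℚ) →+ X := Finsupp.liftAddHom fun i =>
    ((smulAddHom ℝ X).flip (u i)).comp (Rat.castHom ℝ).toAddMonoidHom
  have hι : DenseRange ι := by
    refine (TopologicalSpace.denseRange_denseSeq X).mono ?_
    rintro _ ⟨i, rfl⟩
    exact ⟨Finsupp.single i 1, by simp [ι, u]⟩
  obtain ⟨F, φ, h⟩ := exists_isSeriesReduction ι hq hred
  choose W hW using fun n => h.exists_isPathNhds (hfs n)
  obtain ⟨S, hS⟩ := h.exists_addMonoidHom hq hW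
  exact exists_closed_submodule_of_comap_eq ι hι S
    (le_antisymm (h.comap_le_comap hq (fun n => (hW n).mem_nhds) hS)
      (h.comap_ge_comap hq (fun n => (hW n).mem_nhds) (fun n => (hW n).balanced) hS))

/-! ### Seminorms from invariant metrics, and the conclusion -/

section Gauge

variable {Y : Type*} [AddCommGroup Y]

/-- The pullback of a two-sided invariant metric under a homomorphism. -/
def invariantSeminorm {G : Type*} [Group G] (d : MetricSpace G)
    (hl : ∀ g h k : G, d.dist (g * h) (g * k) = d.dist h k)
    (hr : ∀ g h k : G, d.dist (h * g) (k * g) = d.dist h k)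
    (f : Multiplicative Y →* G) : AddGroupSeminorm Y where
  toFun y := d.dist (f (Multiplicative.ofAdd y)) 1
  map_zero' := by rw [ofAdd_zero, map_one]; exact d.dist_self 1
  add_le' x y := by
    rw [ofAdd_add, map_mul]
    refine (d.dist_triangle _ (f (Multiplicative.ofAdd y)) _).trans ?_
    have := hr (f (Multiplicative.ofAdd y)) (f (Multiplicative.ofAdd x)) 1
    rw [one_mul] at this
    rw [this]
  neg' x := by
    rw [ofAdd_neg, map_inv]
    have := hl (f (Multiplicative.ofAdd x)) (f (Multiplicative.ofAdd x))⁻¹ 1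
    rw [mul_inv_cancel, mul_one] at this
    rw [← this]
    exact d.dist_comm _ _

theorem comap_invariantSeminorm {G : Type*} [Group G] [t : TopologicalSpace G]
    (d : MetricSpace G) (hd : d.toUniformSpace.toTopologicalSpace = t)
    (hl : ∀ g h k : G, d.dist (g * h) (g * k) = d.dist h k)
    (hr : ∀ g h k : G, d.dist (h * g) (k * g) = d.dist h k)
    (f : Multiplicative Y →* G) :
    comap (invariantSeminorm d hl hr f) (𝓝 0) =
      comap (fun y => f (Multiplicative.ofAdd y)) (𝓝 1) := by
  subst hd
  rw [← nhds_comap_dist (1 : G), comap_comap]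
  rfl

/-- The sum of the first `n + 1` terms of a sequence of seminorms. -/
def partialSumSeminorm (p : ℕ → AddGroupSeminorm Y) (n : ℕ) : AddGroupSeminorm Y where
  toFun y := ∑ m ∈ Finset.range (n + 1), p m y
  map_zero' := by simp
  add_le' x y := by
    rw [← Finset.sum_add_distrib]
    exact Finset.sum_le_sum fun m _ => map_add_le_add (p m) x y
  neg' x := by simp

theorem le_partialSumSeminorm (p : ℕ → AddGroupSeminorm Y) {m n : ℕ} (h : m ≤ n) (y : Y) :
    p m y ≤ partialSumSeminorm p n y :=
  Finset.single_le_sum (f := fun m => p m y) (fun m _ => apply_nonneg (p m) y)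
    (Finset.mem_range.2 (by omega))

theorem partialSumSeminorm_mono (p : ℕ → AddGroupSeminorm Y) {m n : ℕ} (h : m ≤ n) (y : Y) :
    partialSumSeminorm p m y ≤ partialSumSeminorm p n y :=
  Finset.sum_le_sum_of_subset_of_nonneg (Finset.range_mono (by omega))
    fun m _ _ => apply_nonneg (p m) y

variable [TopologicalSpace Y]

/-- Partial sums turn finitely many conditions into one on a single seminorm; Cauchy sequences
converge because `Y` is Polish (`exists_tendsto_of_tendsto_sub`). -/
theorem isCompleteGauge_partialSumSeminorm [IsTopologicalAddGroup Y] [PolishSpace Y]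
    {p : ℕ → AddGroupSeminorm Y} (hp : 𝓝 (0 : Y) = ⨅ m, comap (p m) (𝓝 0)) :
    IsCompleteGauge (partialSumSeminorm p) := by
  have hle : ∀ m, Tendsto (p m) (𝓝 0) (𝓝 0) := fun m =>
    tendsto_iff_comap.2 (hp.le.trans (iInf_le _ m))
  have hmem : ∀ U : Set Y, U ∈ 𝓝 0 ↔ ∃ n, ∃ ε > 0, ∀ y, partialSumSeminorm p n y < ε → y ∈ U := by
    intro U
    constructor
    · intro hU
      rw [hp] at hU
      refine iInf_sets_induct hU ⟨0, 1, one_pos, fun _ _ => Set.mem_univ _⟩ ?_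
      rintro m s₁ s₂ hs₁ ⟨n, ε, hε, hs₂⟩
      obtain ⟨δ, hδ, hs₁⟩ := ((nhds_basis_zero_abs_lt ℝ).comap (p m)).mem_iff.1 hs₁
      refine ⟨max m n, min δ ε, lt_min hδ hε, fun y hy => ⟨hs₁ ?_, hs₂ y ?_⟩⟩
      · change |p m y| < δ
        rw [abs_of_nonneg (apply_nonneg _ _)]
        exact (le_partialSumSeminorm p (le_max_left m n) y).trans_lt (hy.trans_le (min_le_left _ _))
      · exact (partialSumSeminorm_mono p (le_max_right m n) y).trans_lt
          (hy.trans_le (min_le_right _ _))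
    · rintro ⟨n, ε, hε, hU⟩
      have : Tendsto (partialSumSeminorm p n) (𝓝 0) (𝓝 0) := by
        have := tendsto_finsetSum (Finset.range (n + 1)) fun m _ => hle m
        rw [Finset.sum_const_zero] at this
        exact this
      exact mem_of_superset (this.eventually_lt_const hε) hU
  refine ⟨fun n y => partialSumSeminorm_mono p (Nat.le_succ n) y, hmem, fun u hu => exists_tendsto_of_tendsto_sub fun U hU => ?_⟩
  obtain ⟨n, ε, hε, hU⟩ := (hmem U).1 hU
  obtain ⟨K, hK⟩ := hu n ε hε
  exact mem_atTop_sets.2 ⟨(K, K), fun b hb => hU _ (hK b.1 hb.1 b.2 hb.2)⟩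

theorem HasFiniteSumsProperty.partialSum {p : ℕ → AddGroupSeminorm Y}
    (hp : ∀ m, HasFiniteSumsProperty (p m)) (n : ℕ) :
    HasFiniteSumsProperty (partialSumSeminorm p n) := by
  choose V hV hVp using hp
  refine ⟨⋂ m ∈ Finset.range (n + 1), V m, (Filter.biInter_finset_mem _).2 fun m _ => hV m,
    fun y hy => ?_⟩
  have : ∃ m ∈ Finset.range (n + 1), ¬ Tendsto (fun r => p m (y r)) atTop (𝓝 0) := by
    by_contra! hcon
    refine hy ?_
    have := tendsto_finsetSum (Finset.range (n + 1)) hcon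
    rw [Finset.sum_const_zero] at this
    exact this
  obtain ⟨m, hm, hmt⟩ := this
  obtain ⟨A, hA⟩ := hVp m y hmt
  exact ⟨A, fun h => hA (Set.mem_iInter₂.1 h m hm)⟩

/-- The ordered product supplied by strong NSS is taken over images of elements of `Y`, so it is the
image under `f` of a finite sum. -/
theorem hasFiniteSumsProperty_invariantSeminorm {G : Type*} [Group G] [t : TopologicalSpace G]
    (d : MetricSpace G) (hd : d.toUniformSpace.toTopologicalSpace = t)
    (hl : ∀ g h k : G, d.dist (g * h) (g * k) = d.dist h k)
    (hr : ∀ g h k : G, d.dist (h * g) (k * g) = d.dist h k)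
    (f : Multiplicative Y →* G) (hf : Continuous f) (hG : IsStronglyNSS G) :
    HasFiniteSumsProperty (invariantSeminorm d hl hr f) := by
  classical
  obtain ⟨V, hVo, hV1, hV⟩ := hG
  have hf' : Continuous fun y : Y => f (Multiplicative.ofAdd y) := hf
  refine ⟨{y | f (Multiplicative.ofAdd y) ∈ V}, (hVo.preimage hf').mem_nhds (by simpa using hV1),
    fun y hy => ?_⟩
  obtain ⟨k, n, hn, hprod⟩ := hV (fun r => f (Multiplicative.ofAdd (y r))) fun ht => hy (by
    subst hd
    exact tendsto_iff_dist_tendsto_zero.1 ht)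
  refine ⟨Finset.univ.image n, fun hmem => hprod ?_⟩
  have e : (List.ofFn fun i => f (Multiplicative.ofAdd (y (n i)))).prod =
      f (Multiplicative.ofAdd (∑ r ∈ Finset.univ.image n, y r)) := by
    rw [Finset.sum_image hn.injective.injOn, ofAdd_sum, ← List.prod_ofFn, map_list_prod,
      List.map_ofFn]
    rfl
  rw [e]
  exact hmem

end Gauge

theorem theorem6
    -- two separable completely metrizable real topological vector spaces
    (X : Type*) [AddCommGroup X] [Module ℝ X] [TopologicalSpace X] [IsTopologicalAddGroup X]
    [ContinuousSMul ℝ X] [PolishSpace X]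
    (Y : Type*) [AddCommGroup Y] [Module ℝ Y] [TopologicalSpace Y] [IsTopologicalAddGroup Y]
    [ContinuousSMul ℝ Y] [PolishSpace Y]
    -- a sequence of TSI strongly NSS Polish groups
    (H : ℕ → Type*) [∀ m, Group (H m)] [∀ m, TopologicalSpace (H m)]
    [∀ m, IsTopologicalGroup (H m)] [∀ m, PolishSpace (H m)]
    (hTSI : ∀ m, IsTSI (H m)) (hNSS : ∀ m, IsStronglyNSS (H m))
    -- the additive group of `Y` is a closed subgroup of the product
    (j : Multiplicative Y →* (∀ m, H m)) (hj : IsClosedEmbedding j) :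
    BorelReducible (inducedRel (Multiplicative X)) (inducedRel (Multiplicative Y)) ↔
      ∃ Z : Submodule ℝ Y, IsClosed (Z : Set Y) ∧ Nonempty (X ≃L[ℝ] Z) := by
  constructor
  · intro hred
    choose d hd hl hr using hTSI
    let f : ∀ m, Multiplicative Y →* H m := fun m => (Pi.evalMonoidHom H m).comp j
    have hf : ∀ m, Continuous (f m) := fun m => (continuous_apply m).comp hj.continuous
    let p : ℕ → AddGroupSeminorm Y := fun m => invariantSeminorm (d m) (hl m) (hr m) (f m)
    -- The embedding gives `Y` the initial topology for the coordinate maps to the `H m`, whose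
    -- metrics pull back to the `p m`.
    have hp : 𝓝 (0 : Y) = ⨅ m, comap (p m) (𝓝 0) := by
      have h1 : 𝓝 (0 : Y) = comap (fun y => j (Multiplicative.ofAdd y)) (𝓝 1) := by
        have := hj.isInducing.nhds_eq_comap (1 : Multiplicative Y)
        rw [map_one] at this
        exact this
      rw [h1, nhds_pi, Filter.pi, comap_iInf]
      refine iInf_congr fun m => ?_
      rw [comap_invariantSeminorm _ (hd m), comap_comap]
      rfl
    exact exists_closed_submodule_of_borelReducible (isCompleteGauge_partialSumSeminorm hp)
      (HasFiniteSumsProperty.partialSum fun m =>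
        hasFiniteSumsProperty_invariantSeminorm (d m) (hd m) (hl m) (hr m) (f m) (hf m) (hNSS m))
      hred
  · rintro ⟨Z, hZ, ⟨e⟩⟩
    exact borelReducible_of_closed_submodule Z hZ e
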